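/- **Setting.** Let $H^1(\mathbb R^3)$ be the real Sobolev space with its standard norm and $H^{-1}(\mathbb R^3)$ its dual with the dual norm. For $\xi>0$ put $(u,v)_\xi=(\nabla u,\nabla v)_{L^2}+\xi^{-2}(u,v)_{L^2}$ on $H^1(\mathbb R^3)$. For a closed set $K\subset\mathbb R^3$ let $H^1_0(\mathbb R^3\setminus K)$ be the closure in $H^1(\mathbb R^3)$ of the set of $\varphi\in C_c^\infty(\mathbb R^3)$ with $\varphi=0$ on $K$. Given $f\in H^{-1}(\mathbb R^3)$, a weak solution of $$-\Delta u+\xi^{-2}u=f\ \text{ in }\mathbb R^3\setminus K,\qquad u=0\ \text{ in }K \tag{1}$$ is a $u\in H^1_0(\mathbb R^3\setminus K)$ with $(u,v)_\xi=\langle f,v\rangle$ for all $v\in H^1_0(\mathbb R^3\setminus K)$. Let $I$ be a finite or countable index set, $x_i\in\mathbb R^3$, $r_i>0$, $B_i=\overline{B_{r_i}(x_i)}$, $d_i=\inf_{j\ne i}|x_i-x_j|$ (with $d_i=\infty$ if there is no other particle), and assume that $K=\bigcup_{i\in I}B_i$ is closed. Let $Q_i$ be the projection of $H^1(\mathbb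 R^3)$, orthogonal with respect to $(\cdot,\cdot)_\xi$, onto the orthogonal complement of $H^1_0(\mathbb R^3\setminus B_i)$. The corrections of the Method of Reflections for $f$ are $\Phi_0=(-\Delta+\xi^{-2})^{-1}f\in H^1(\mathbb R^3)$ and, for $k\ge1$, $\Phi_k=\sum_{i}\Phi_{k,i}$, where $\Phi_{1,i}=-Q_i\Phi_0$ and $\Phi_{k,i}=-Q_i\sum_{j\neq i}\Phi_{k-1,j}$ for $k\ge2$. For $\gamma\in(0,1]$ and $0\le k\le N$ put $q_\gamma(0,N)=1$ and, for $1\le k\le N$, $$q_\gamma(k,N)=\frac{N!}{(N-k)!\,(k-1)!}\int_0^\gamma t^{k-1}(1-t)^{N-k}\,dt .$$ **Theorem.** There is a function $C:(0,\infty)\to\mathbb R$ with the following property. For all constants $\alpha$, $\kappa>1$ and $C_*<\infty$ there are $\gamma\in(0,1]$ and $\varepsilon\in(0,1)$, depending only on $\alpha,\kappa,C_*$, such that $\lim_{N\to\infty}q_\gamma(k,N)=1$ for every $k\in\mathbb N$, and such that the following holds for all $\xi>0$, all $\mu_0$ with $\mu_0\le C_*\xi^{-2}$, all particle configurations as above with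 $$r_i d_i^{-3}\le\mu_0,\qquad \tfrac{d_i}{2}>\kappa r_i,\qquad r_i\le\alpha\xi\qquad\text{for all } i\in I,$$ and all $f\in H^{-1}(\mathbb R^3)$. The series defining the $\Phi_k$ converge unconditionally in $H^1(\mathbb R^3)$, problem (1) has a unique weak solution $u$, the modified partial sums $\Psi_N=\sum_{k=0}^N q_\gamma(k,N)\Phi_k$ converge to $u$ in $H^1(\mathbb R^3\setminus K)$ as $N\to\infty$, and $$\|\Psi_N-u\|_{H^1(\mathbb R^3\setminus K)}\le C(\xi)\,\varepsilon^N\,\|f\|_{H^{-1}(\mathbb R^3)}\qquad\text{for all }N\in\mathbb N .$$ -/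

import Mathlib

open MeasureTheory Filter Topology
open scoped ENNReal ContDiff

namespace ScreenedReflections

noncomputable section

/-- Physical space `ℝ³` with its Euclidean norm. -/
abbrev E3 : Type := EuclideanSpace ℝ (Fin 3)

/-- `L²(ℝ³)`. -/
abbrev L2fun : Type := Lp ℝ 2 (volume : Measure E3)

/-- `L²(ℝ³; ℝ³)`. -/
abbrev L2vec : Type := Lp E3 2 (volume : Measure E3)

/-- `g` is the weak (distributional) gradient of `u` on `ℝ³`. -/
def IsWeakGradient (u : E3 → ℝ) (g : E3 → E3) : Prop :=
  ∀ φ : E3 → ℝ, ContDiff ℝ ∞ φ → HasCompactSupport φ → ∀ i : Fin 3,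
    ∫ y, u y * fderiv ℝ φ y (EuclideanSpace.single i 1) = - ∫ y, g y i * φ y

theorem memLp_test {φ : E3 → ℝ} (hφ : ContDiff ℝ ∞ φ) (hc : HasCompactSupport φ) :
    MemLp φ 2 (volume : Measure E3) :=
  hφ.continuous.memLp_of_hasCompactSupport hc

theorem memLp_testDeriv {φ : E3 → ℝ} (hφ : ContDiff ℝ ∞ φ) (hc : HasCompactSupport φ) (v : E3) :
    MemLp (fun y => fderiv ℝ φ y v) 2 (volume : Measure E3) :=
  ((hφ.continuous_fderiv (by simp)).clm_apply continuous_const).memLp_of_hasCompactSupport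
    (hc.fderiv_apply (𝕜 := ℝ) v)

/-- The integral of an `L²` function against an `L²` function, as an `L²` scalar product. -/
theorem integral_mul_eq_inner (u : L2fun) {ψ : E3 → ℝ} (hψ : MemLp ψ 2 (volume : Measure E3)) :
    ∫ y, u y * ψ y = inner ℝ (hψ.toLp ψ) u := by
  rw [L2.inner_def]
  refine integral_congr_ae ?_
  filter_upwards [hψ.coeFn_toLp] with y hy
  simp [hy]

/-- The vector field `ψ e_i` is square integrable when `ψ` is. -/
theorem memLp_smul_single {ψ : E3 → ℝ} (hψ : MemLp ψ 2 (volume : Measure E3)) (i : Fin 3) :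
    MemLp (fun y => ψ y • (EuclideanSpace.single i 1 : E3)) 2 (volume : Measure E3) := by
  have := (ContinuousLinearMap.toSpanSingleton ℝ (EuclideanSpace.single i 1 : E3)).comp_memLp' hψ
  simpa [Function.comp_def] using this

theorem integral_coord_mul_eq_inner (g : L2vec) {ψ : E3 → ℝ}
    (hψ : MemLp ψ 2 (volume : Measure E3)) (i : Fin 3) :
    ∫ y, g y i * ψ y = inner ℝ ((memLp_smul_single hψ i).toLp _) g := by
  rw [L2.inner_def]
  refine integral_congr_ae ?_
  filter_upwards [(memLp_smul_single hψ i).coeFn_toLp] with y hy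
  rw [hy, inner_smul_left, EuclideanSpace.inner_single_left]
  simp [mul_comm]

/-- A weak gradient pairing written with `L²` scalar products. -/
theorem isWeakGradient_iff (p : WithLp 2 (L2fun × L2vec)) :
    IsWeakGradient p.fst p.snd ↔
      ∀ (φ : E3 → ℝ) (hφ : ContDiff ℝ ∞ φ) (hc : HasCompactSupport φ) (i : Fin 3),
        inner ℝ ((memLp_testDeriv hφ hc (EuclideanSpace.single i 1)).toLp _) p.fst
          + inner ℝ ((memLp_smul_single (memLp_test hφ hc) i).toLp _) p.snd = 0 := by
  refine forall_congr' fun φ => forall_congr' fun hφ => forall_congr' fun hc =>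
    forall_congr' fun i => ?_
  rw [integral_mul_eq_inner p.fst (memLp_testDeriv hφ hc (EuclideanSpace.single i 1)),
    integral_coord_mul_eq_inner p.snd (memLp_test hφ hc) i, eq_neg_iff_add_eq_zero]

/-- The pairs `(u, ∇u)` in `L² × L²` where `∇u` is the weak gradient of `u`. -/
def sobolevSubmodule : Submodule ℝ (WithLp 2 (L2fun × L2vec)) where
  carrier := {p | IsWeakGradient p.fst p.snd}
  zero_mem' := by
    rw [Set.mem_ofPred_eq, isWeakGradient_iff]
    intro φ hφ hc i
    simp
  add_mem' := by
    intro p q hp hq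
    rw [Set.mem_ofPred_eq, isWeakGradient_iff] at *
    intro φ hφ hc i
    have h1 := hp φ hφ hc i
    have h2 := hq φ hφ hc i
    rw [WithLp.add_fst, WithLp.add_snd, inner_add_right, inner_add_right]
    linarith
  smul_mem' := by
    intro c p hp
    rw [Set.mem_ofPred_eq, isWeakGradient_iff] at *
    intro φ hφ hc i
    have h1 := hp φ hφ hc i
    rw [WithLp.smul_fst, WithLp.smul_snd, real_inner_smul_right, real_inner_smul_right,
      ← mul_add, h1, mul_zero]

theorem isClosed_sobolevSubmodule : IsClosed (sobolevSubmodule : Set (WithLp 2 (L2fun × L2vec))) := by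
  have h : (sobolevSubmodule : Set (WithLp 2 (L2fun × L2vec))) =
      ⋂ (φ : E3 → ℝ) (hφ : ContDiff ℝ ∞ φ) (hc : HasCompactSupport φ) (i : Fin 3),
        {p | inner ℝ ((memLp_testDeriv hφ hc (EuclideanSpace.single i 1)).toLp _) p.fst
          + inner ℝ ((memLp_smul_single (memLp_test hφ hc) i).toLp _) p.snd = 0} := by
    ext p
    simp only [Set.mem_iInter]
    exact isWeakGradient_iff p
  rw [h]
  refine isClosed_iInter fun φ => isClosed_iInter fun hφ => isClosed_iInter fun hc =>
    isClosed_iInter fun i => isClosed_eq ?_ continuous_const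
  have h1 : Continuous fun p : WithLp 2 (L2fun × L2vec) => p.fst :=
    (WithLp.prod_continuous_ofLp 2 L2fun L2vec).fst
  have h2 : Continuous fun p : WithLp 2 (L2fun × L2vec) => p.snd :=
    (WithLp.prod_continuous_ofLp 2 L2fun L2vec).snd
  exact (continuous_const.inner h1).add (continuous_const.inner h2)

/-- The Sobolev space `H¹(ℝ³)`, of the pairs `(u, ∇u)` in `L² × L²` where `∇u` is the weak gradient
of `u`, with its standard norm `‖u‖² = ‖u‖²_{L²} + ‖∇u‖²_{L²}`. -/
def H1 : Type := sobolevSubmodule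

instance : NormedAddCommGroup H1 := inferInstanceAs (NormedAddCommGroup sobolevSubmodule)

instance : InnerProductSpace ℝ H1 := inferInstanceAs (InnerProductSpace ℝ sobolevSubmodule)

instance : CompleteSpace H1 :=
  isClosed_sobolevSubmodule.completeSpace_coe

/-- The inclusion of `H¹(ℝ³)` into `L² × L²`. -/
def pairL : H1 →L[ℝ] WithLp 2 (L2fun × L2vec) := sobolevSubmodule.subtypeL

/-- The dual space `H⁻¹(ℝ³)` with its standard (dual) norm. -/
abbrev Hneg1 : Type := StrongDual ℝ H1

/-- The `L²` function underlying an element of `H¹(ℝ³)`. -/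
def toFun : H1 →L[ℝ] L2fun := (WithLp.fstL 2 ℝ L2fun L2vec).comp pairL

/-- The weak gradient of an element of `H¹(ℝ³)`. -/
def grad : H1 →L[ℝ] L2vec := (WithLp.sndL 2 ℝ L2fun L2vec).comp pairL

/-- The scalar product `(u, v)_{H¹_ξ} = (∇u, ∇v)_{L²} + ξ⁻² (u, v)_{L²}`. -/
def screenedForm (ξ : ℝ) : H1 →L[ℝ] H1 →L[ℝ] ℝ :=
  (innerSL ℝ).bilinearComp grad grad + (ξ ^ 2)⁻¹ • (innerSL ℝ).bilinearComp toFun toFun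

theorem screenedForm_apply (ξ : ℝ) (u v : H1) :
    screenedForm ξ u v
      = inner ℝ (grad u) (grad v) + (ξ ^ 2)⁻¹ * inner ℝ (toFun u) (toFun v) := by
  simp [screenedForm]

/-- The `H¹`-norm over a set `Ω` of (the restriction to `Ω` of) an element of `H¹(ℝ³)`. -/
def normOn (Ω : Set E3) (u : H1) : ℝ :=
  Real.sqrt ((∫ y in Ω, (toFun u y) ^ 2) + ∫ y in Ω, ‖grad u y‖ ^ 2)

/-- The smooth compactly supported functions that vanish on `K`, as elements of `H¹(ℝ³)`. -/
def testFunctions (K : Set E3) : Submodule ℝ H1 where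
  carrier := {u | ∃ φ : E3 → ℝ, ContDiff ℝ ∞ φ ∧ HasCompactSupport φ ∧ (∀ y ∈ K, φ y = 0) ∧
    toFun u =ᵐ[volume] φ}
  zero_mem' := ⟨0, contDiff_const, HasCompactSupport.zero, fun _ _ => rfl, by
    rw [map_zero]; exact Lp.coeFn_zero ℝ 2 volume⟩
  add_mem' := by
    rintro u v ⟨φ, h1, h2, h3, h4⟩ ⟨ψ, k1, k2, k3, k4⟩
    refine ⟨φ + ψ, h1.add k1, h2.add k2, fun y hy => by simp [h3 y hy, k3 y hy], ?_⟩
    rw [map_add]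
    exact (Lp.coeFn_add _ _).trans (h4.add k4)
  smul_mem' := by
    rintro c u ⟨φ, h1, h2, h3, h4⟩
    refine ⟨c • φ, contDiff_const.smul h1, h2.smul_left, fun y hy => by simp [h3 y hy], ?_⟩
    rw [map_smul]
    exact (Lp.coeFn_smul _ _).trans (h4.const_smul c)

/-- `H¹₀(ℝ³ ∖ K)`, a closed subspace of `H¹(ℝ³)`: the closure in `H¹(ℝ³)` of the functions in
`C_c^∞(ℝ³)` that vanish on `K`. -/
def H10 (K : Set E3) : Submodule ℝ H1 := (testFunctions K).topologicalClosure

theorem isClosed_H10 (K : Set E3) : IsClosed (H10 K : Set H1) :=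
  (testFunctions K).isClosed_topologicalClosure

/-- Weak solutions of `-Δu + ξ⁻² u = f` in the subspace `V` of `H¹(ℝ³)`. For `V = H10 K` this is
the weak formulation of `-Δu + ξ⁻² u = f` in `ℝ³ ∖ K`, `u = 0` in `K`. -/
def IsWeakSolution (ξ : ℝ) (V : Submodule ℝ H1) (f : Hneg1) (u : H1) : Prop :=
  u ∈ V ∧ ∀ v ∈ V, screenedForm ξ u v = f v

theorem screenedForm_coercive (ξ : ℝ) (u : H1) :
    min 1 (ξ ^ 2)⁻¹ * ‖u‖ * ‖u‖ ≤ screenedForm ξ u u := by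
  have h : ‖u‖ ^ 2 = ‖toFun u‖ ^ 2 + ‖grad u‖ ^ 2 := WithLp.prod_norm_sq_eq_of_L2 _
  have h1 := mul_le_mul_of_nonneg_right (min_le_left 1 (ξ ^ 2)⁻¹) (sq_nonneg ‖grad u‖)
  have h2 := mul_le_mul_of_nonneg_right (min_le_right 1 (ξ ^ 2)⁻¹) (sq_nonneg ‖toFun u‖)
  rw [screenedForm_apply, real_inner_self_eq_norm_sq, real_inner_self_eq_norm_sq, mul_assoc,
    ← sq, h]
  linarith

/-- Weak solutions exist and are unique, so that the definitions by choice below are meaningful. -/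
theorem existsUnique_isWeakSolution {ξ : ℝ} (hξ : 0 < ξ) {V : Submodule ℝ H1}
    (hV : IsClosed (V : Set H1)) (f : Hneg1) : ∃! u, IsWeakSolution ξ V f u := by
  have : CompleteSpace V := hV.completeSpace_coe
  have hpos : 0 < min 1 (ξ ^ 2)⁻¹ := lt_min one_pos (by positivity)
  let B : V →L[ℝ] V →L[ℝ] ℝ := (screenedForm ξ).bilinearComp V.subtypeL V.subtypeL
  have hB : IsCoercive B := ⟨min 1 (ξ ^ 2)⁻¹, hpos, fun u => screenedForm_coercive ξ u⟩
  let w : V := (InnerProductSpace.toDual ℝ V).symm (f.comp V.subtypeL)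
  let u : V := hB.continuousLinearEquivOfBilin.symm w
  have hu : ∀ v : V, B u v = f v := by
    intro v
    have h1 := hB.continuousLinearEquivOfBilin_apply u v
    rw [← h1, ContinuousLinearEquiv.apply_symm_apply, InnerProductSpace.toDual_symm_apply]
    rfl
  refine ⟨u, ⟨u.2, fun v hv => hu ⟨v, hv⟩⟩, ?_⟩
  rintro z ⟨hz, hz'⟩
  have hd : z - (u : H1) ∈ V := V.sub_mem hz u.2
  have h0 : screenedForm ξ (z - u) (z - u) = 0 := by
    have e1 := hz' _ hd
    have e2 : screenedForm ξ (u : H1) (z - u) = f (z - u) := hu ⟨_, hd⟩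
    rw [map_sub (screenedForm ξ), sub_apply, e1, e2, sub_self]
  have h1 := screenedForm_coercive ξ (z - (u : H1))
  rw [h0, mul_assoc] at h1
  have h2 : ‖z - (u : H1)‖ * ‖z - (u : H1)‖ ≤ 0 := by
    by_contra hcon
    push Not at hcon
    exact absurd h1 (not_le.mpr (mul_pos hpos hcon))
  have h3 : ‖z - (u : H1)‖ = 0 := mul_self_eq_zero.mp (le_antisymm h2 (mul_self_nonneg _))
  exact sub_eq_zero.mp (norm_eq_zero.mp h3)

open Classical in
/-- The weak solution of `-Δu + ξ⁻² u = f` in the closed subspace `V`. -/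
def weakSolution (ξ : ℝ) (V : Submodule ℝ H1) (f : Hneg1) : H1 :=
  if h : ∃ u, IsWeakSolution ξ V f u then h.choose else 0

theorem weakSolution_spec {ξ : ℝ} (hξ : 0 < ξ) {V : Submodule ℝ H1}
    (hV : IsClosed (V : Set H1)) (f : Hneg1) : IsWeakSolution ξ V f (weakSolution ξ V f) := by
  have h := (existsUnique_isWeakSolution hξ hV f).exists
  rw [weakSolution, dif_pos h]
  exact h.choose_spec

/-- The whole-space solution operator `G₀ = (-Δ + ξ⁻²)⁻¹ : H⁻¹(ℝ³) → H¹(ℝ³)`. -/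
def wholeSpaceSolution (ξ : ℝ) (f : Hneg1) : H1 := weakSolution ξ ⊤ f

/-- The orthogonal projection of `H¹(ℝ³)` onto the closed subspace `V` for the scalar product
`(·,·)_{H¹_ξ}`: the element `w` of `V` with `(w, v)_{H¹_ξ} = (u, v)_{H¹_ξ}` for all `v ∈ V`. -/
def screenedProj (ξ : ℝ) (V : Submodule ℝ H1) (u : H1) : H1 := weakSolution ξ V (screenedForm ξ u)

section Particles

variable {I : Type*}

/-- The union `K` of all particles, the closed balls of radius `r i` around `x i`. -/
def particles (x : I → E3) (r : I → ℝ) : Set E3 := ⋃ i, Metric.closedBall (x i) (r i)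

/-- The distance `d_i` from `x i` to the nearest other centre (`∞` if there is none). -/
def nearestDist (x : I → E3) (i : I) : ℝ≥0∞ := ⨅ (j : I) (_ : j ≠ i), edist (x i) (x j)

/-- `Q_i`: the orthogonal projection, for `(·,·)_{H¹_ξ}`, onto the orthogonal complement of
`H¹₀(ℝ³ ∖ B_i)`. Thus `Q_i u` equals `u` in `B_i` and solves the homogeneous equation outside. -/
def particleProj (ξ : ℝ) (x : I → E3) (r : I → ℝ) (i : I) (u : H1) : H1 :=
  u - screenedProj ξ (H10 (Metric.closedBall (x i) (r i))) u

/-- The corrections of single particles in the method of reflections, with the order shifted by one: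
`correction ξ x r f k i` is `Φ_{k+1,i}`, where `Φ_{1,i} = -Q_i Φ_0`, `Φ_0 = G₀ f`, and
`Φ_{k,i} = -Q_i ∑_{j ≠ i} Φ_{k-1,j}` for `k ≥ 2`. -/
def correction (ξ : ℝ) (x : I → E3) (r : I → ℝ) (f : Hneg1) : ℕ → I → H1
  | 0, i => - particleProj ξ x r i (wholeSpaceSolution ξ f)
  | k + 1, i => - particleProj ξ x r i (∑' j : {j : I // j ≠ i}, correction ξ x r f k j)

/-- The corrections `Φ_k` of the method of reflections:
`Φ_0 = G₀ f` and `Φ_k = ∑_i Φ_{k,i}` for `k ≥ 1`. -/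
def reflection (ξ : ℝ) (x : I → E3) (r : I → ℝ) (f : Hneg1) : ℕ → H1
  | 0 => wholeSpaceSolution ξ f
  | k + 1 => ∑' i, correction ξ x r f k i

end Particles

/-- The weights `q(k, N)` with parameter `γ`: `q(0, N) = 1` and, for `1 ≤ k ≤ N`,
`q(k, N) = N! / ((N - k)! (k - 1)!) * B(γ; k, N - k + 1)`, where
`B(γ; a, b) = ∫₀^γ t^(a-1) (1-t)^(b-1) dt` is the incomplete Beta function. -/
def betaWeight (γ : ℝ) (k N : ℕ) : ℝ :=
  if k = 0 then 1
  else if k ≤ N then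
    (N.factorial : ℝ) / ((N - k).factorial * (k - 1).factorial)
      * ∫ t in (0 : ℝ)..γ, t ^ (k - 1) * (1 - t) ^ (N - k)
  else 0

/-- The modified partial sums `Ψ_N = ∑_{k=0}^N q(k, N) Φ_k`. -/
def modifiedSum {I : Type*} (γ ξ : ℝ) (x : I → E3) (r : I → ℝ) (f : Hneg1) (N : ℕ) : H1 :=
  ∑ k ∈ Finset.range (N + 1), betaWeight γ k N • reflection ξ x r f k

end

end ScreenedReflections

/-! Put L = Σ Q_i. Since Q_i fixes Φ_{k,i}, the omitted diagonal term can be restored, and the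
corrections satisfy Φ_1 = -LΦ_0 and Φ_{k+1} = (1 - L)Φ_k for k ≥ 1. The weight q_γ(k, N) is the
probability that a binomial variable with parameters N, γ is at least k. Its Pascal recursion
(`betaWeight_succ_succ`) turns the modified sums into the relaxed iteration Ψ_N = (1 - γL)^N Φ_0
(`weighted_sum_succ`). The operator L is symmetric for the screened form and vanishes on H¹₀(ℝ³ ∖
K), while Φ_0 - u is orthogonal to that space. So it suffices to find Λ > 1, depending only on the
given constants, such that Λ⁻¹ ≤ L ≤ Λ on the orthogonal complement: then γ = Λ⁻¹ contracts the
squared energy of the error by 1 - Λ⁻² in each step (`IsBesselFamily.contraction`).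

Upper bound: Q_i u has least energy among the functions that agree with u on B_i, so the cut-off
function η_i u is a competitor. Its energy is controlled by that of u on a ball of radius R_i about
x_i, and these balls are disjoint (`exists_energy_bound`). The dangerous term r_i⁻² ∫ u² near the
particle is handled by a local Hardy inequality (`exists_local_hardy`), whose zero-order remainder
has the coefficient r_i / R_i³; the capacity density bound makes this at most a multiple of ξ⁻². The
inequality comes from the vector field -∇w/w with w a regularised version of the superharmonic
function 1 + r/|y - x|.

Lower bound (`IsSeparated.gap`): for v orthogonal to H¹₀(ℝ³ ∖ K), the function W = Σ η_i Q_i v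
agrees with v on every particle, so v has at most the energy of W. The summands of W have disjoint
supports, so that energy is at most Λ Σ (Q_i v, Q_i v) = Λ (Lv, v).

Agreement on K is meant in the sense of H¹₀. This requires density of test functions in H¹(ℝ³)
(`H10_empty`) and the gluing of the conditions on single balls (`mem_H10_particles`), where
closedness of K enters through local finiteness. -/

namespace ScreenedReflections

noncomputable section

open scoped Gradient

/-! ### Calculus of weak gradients -/

/-- The element of `H¹(ℝ³)` with given function and weak gradient. -/
def mkH1 (u : L2fun) (g : L2vec) (h : IsWeakGradient u g) : H1 :=
  (⟨WithLp.toLp 2 (u, g), h⟩ : sobolevSubmodule)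

theorem isWeakGradient_grad (u : H1) : IsWeakGradient (toFun u) (grad u) := u.2

theorem H1_ext_pair {u v : H1} (h : toFun u = toFun v) (h' : grad u = grad v) : u = v := by
  apply Subtype.ext
  exact WithLp.ofLp_injective 2 (Prod.ext h h')

theorem norm_sq_H1 (u : H1) : ‖u‖ ^ 2 = ‖toFun u‖ ^ 2 + ‖grad u‖ ^ 2 :=
  WithLp.prod_norm_sq_eq_of_L2 _

theorem IsWeakGradient.congr_ae {u u' : E3 → ℝ} {g g' : E3 → E3} (h : IsWeakGradient u g)
    (hu : u =ᵐ[volume] u') (hg : g =ᵐ[volume] g') : IsWeakGradient u' g' := by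
  intro φ hφ hc i
  have h1 : ∫ y, u' y * fderiv ℝ φ y (EuclideanSpace.single i 1)
      = ∫ y, u y * fderiv ℝ φ y (EuclideanSpace.single i 1) :=
    integral_congr_ae (by filter_upwards [hu] with y hy; rw [hy])
  have h2 : ∫ y, g' y i * φ y = ∫ y, g y i * φ y :=
    integral_congr_ae (by filter_upwards [hg] with y hy; rw [hy])
  rw [h1, h2]
  exact h φ hφ hc i

theorem gradient_apply (f : E3 → ℝ) (y : E3) (i : Fin 3) :
    (∇ f y) i = fderiv ℝ f y (EuclideanSpace.single i 1) := by
  rw [← inner_gradient_left, EuclideanSpace.inner_single_right]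
  simp

theorem continuous_gradient {f : E3 → ℝ} (hf : ContDiff ℝ ∞ f) : Continuous (∇ f) :=
  (InnerProductSpace.toDual ℝ E3).symm.continuous.comp (hf.continuous_fderiv (by simp))

theorem HasCompactSupport.gradient {f : E3 → ℝ} (hc : HasCompactSupport f) :
    HasCompactSupport (∇ f) :=
  (HasCompactSupport.fderiv (𝕜 := ℝ) hc).comp_left (map_zero _)

theorem gradient_mul {f g : E3 → ℝ} {y : E3} (hf : DifferentiableAt ℝ f y)
    (hg : DifferentiableAt ℝ g y) :
    ∇ (fun z => f z * g z) y = f y • ∇ g y + g y • ∇ f y := by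
  unfold _root_.gradient
  rw [show (fun z => f z * g z) = f * g from rfl, fderiv_mul hf hg]
  simp

theorem isWeakGradient_gradient {f : E3 → ℝ} (hf : ContDiff ℝ ∞ f) : IsWeakGradient f (∇ f) := by
  intro φ hφ hc i
  simp_rw [gradient_apply]
  have c1 : Continuous fun y => fderiv ℝ f y (EuclideanSpace.single i 1) :=
    (hf.continuous_fderiv (by simp)).clm_apply continuous_const
  have c2 : Continuous fun y => fderiv ℝ φ y (EuclideanSpace.single i 1) :=
    (hφ.continuous_fderiv (by simp)).clm_apply continuous_const
  refine integral_mul_fderiv_eq_neg_fderiv_mul_of_integrable ?_ ?_ ?_ ?_ ?_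
  · exact (c1.mul hφ.continuous).integrable_of_hasCompactSupport hc.mul_left
  · exact (hf.continuous.mul c2).integrable_of_hasCompactSupport
      (hc.fderiv_apply (𝕜 := ℝ) _).mul_left
  · exact (hf.continuous.mul hφ.continuous).integrable_of_hasCompactSupport hc.mul_left
  · exact fun y _ => (hf.differentiable (by simp)) y
  · exact fun y _ => (hφ.differentiable (by simp)) y

theorem memLp_coord {g : E3 → E3} (hg : MemLp g 2 (volume : Measure E3)) (i : Fin 3) :
    MemLp (fun y => g y i) 2 (volume : Measure E3) :=
  (EuclideanSpace.proj i : E3 →L[ℝ] ℝ).comp_memLp' hg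

/-- The product `η * φ` is again a test function; testing the weak gradient of `u` with it and
expanding its derivative gives the product rule. -/
theorem IsWeakGradient.mul {u : E3 → ℝ} {g : E3 → E3} (h : IsWeakGradient u g)
    (hu : MemLp u 2 (volume : Measure E3)) (hg : MemLp g 2 (volume : Measure E3)) {η : E3 → ℝ}
    (hη : ContDiff ℝ ∞ η) :
    IsWeakGradient (fun y => η y * u y) (fun y => η y • g y + u y • ∇ η y) := by
  intro φ hφ hc i
  have hprod : ContDiff ℝ ∞ fun y => η y * φ y := hη.mul hφ
  have hprodc : HasCompactSupport fun y => η y * φ y := hc.mul_left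
  have key := h _ hprod hprodc i
  have hder : ∀ y, fderiv ℝ (fun y => η y * φ y) y (EuclideanSpace.single i 1)
      = η y * fderiv ℝ φ y (EuclideanSpace.single i 1)
        + φ y * fderiv ℝ η y (EuclideanSpace.single i 1) := by
    intro y
    rw [show (fun y => η y * φ y) = η * φ from rfl, fderiv_mul ((hη.differentiable (by simp)) y)
      ((hφ.differentiable (by simp)) y)]
    simp
  have cη : Continuous fun y => fderiv ℝ η y (EuclideanSpace.single i 1) :=
    (hη.continuous_fderiv (by simp)).clm_apply continuous_const
  have cφ : Continuous fun y => fderiv ℝ φ y (EuclideanSpace.single i 1) :=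
    (hφ.continuous_fderiv (by simp)).clm_apply continuous_const
  have m1 : MemLp (fun y => η y * fderiv ℝ φ y (EuclideanSpace.single i 1)) 2
      (volume : Measure E3) :=
    (hη.continuous.mul cφ).memLp_of_hasCompactSupport (hc.fderiv_apply (𝕜 := ℝ) _).mul_left
  have m2 : MemLp (fun y => φ y * fderiv ℝ η y (EuclideanSpace.single i 1)) 2
      (volume : Measure E3) :=
    (hφ.continuous.mul cη).memLp_of_hasCompactSupport hc.mul_right
  have m3 : MemLp (fun y => η y * φ y) 2 (volume : Measure E3) := memLp_test hprod hprodc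
  have i1 : Integrable fun y => u y * (η y * fderiv ℝ φ y (EuclideanSpace.single i 1)) :=
    hu.integrable_mul m1
  have i2 : Integrable fun y => u y * (φ y * fderiv ℝ η y (EuclideanSpace.single i 1)) :=
    hu.integrable_mul m2
  have i3 : Integrable fun y => g y i * (η y * φ y) := (memLp_coord hg i).integrable_mul m3
  have e1 : ∫ y, η y * u y * fderiv ℝ φ y (EuclideanSpace.single i 1)
      = ∫ y, u y * (η y * fderiv ℝ φ y (EuclideanSpace.single i 1)) :=
    integral_congr_ae (Eventually.of_forall fun y => by ring)
  have e2 : ∫ y, (η y • g y + u y • ∇ η y) i * φ y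
      = ∫ y, (g y i * (η y * φ y) + u y * (φ y * fderiv ℝ η y (EuclideanSpace.single i 1))) :=
    integral_congr_ae (Eventually.of_forall fun y => by
      simp only [PiLp.add_apply, PiLp.smul_apply, smul_eq_mul, gradient_apply]; ring)
  rw [e1, e2, integral_add i3 i2]
  simp_rw [hder, mul_add] at key
  rw [integral_add i1 i2] at key
  linarith

theorem toFun_memLp (u : H1) : MemLp (toFun u) 2 (volume : Measure E3) := Lp.memLp _

theorem grad_memLp (u : H1) : MemLp (grad u) 2 (volume : Measure E3) := Lp.memLp _

/-- Weak gradients are unique. -/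
theorem IsWeakGradient.ae_eq {u : E3 → ℝ} {g g' : E3 → E3} (h : IsWeakGradient u g)
    (h' : IsWeakGradient u g') (hg : MemLp g 2 (volume : Measure E3))
    (hg' : MemLp g' 2 (volume : Measure E3)) : g =ᵐ[volume] g' := by
  have hi : ∀ i : Fin 3, ∀ᵐ y, g y i = g' y i := by
    intro i
    refine ae_eq_of_integral_contDiff_smul_eq
      ((memLp_coord hg i).locallyIntegrable (by norm_num))
      ((memLp_coord hg' i).locallyIntegrable (by norm_num)) fun φ hφ hc => ?_
    have := (h φ hφ hc i).symm.trans (h' φ hφ hc i)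
    simp only [smul_eq_mul, mul_comm (φ _)]
    linarith
  filter_upwards [ae_all_iff.2 hi] with y hy
  ext i
  exact hy i

/-- The weak gradient is determined by the function, so identities in `H1` need only be checked on
the underlying `L²` functions. -/
theorem H1_ext {u v : H1} (h : toFun u = toFun v) : u = v := by
  refine H1_ext_pair h (Lp.ext ?_)
  refine (isWeakGradient_grad u).ae_eq ?_ (grad_memLp u) (grad_memLp v)
  rw [h]
  exact isWeakGradient_grad v

/-- A smooth function, square integrable together with its gradient, as an element of `H¹(ℝ³)`. -/
def ofSmooth (f : E3 → ℝ) (hf : ContDiff ℝ ∞ f) (h0 : MemLp f 2 (volume : Measure E3))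
    (h1 : MemLp (∇ f) 2 (volume : Measure E3)) : H1 :=
  mkH1 (h0.toLp f) (h1.toLp _)
    ((isWeakGradient_gradient hf).congr_ae h0.coeFn_toLp.symm h1.coeFn_toLp.symm)

theorem toFun_ofSmooth {f : E3 → ℝ} (hf : ContDiff ℝ ∞ f) (h0 : MemLp f 2 (volume : Measure E3))
    (h1 : MemLp (∇ f) 2 (volume : Measure E3)) : toFun (ofSmooth f hf h0 h1) =ᵐ[volume] f :=
  h0.coeFn_toLp

theorem grad_ofSmooth {f : E3 → ℝ} (hf : ContDiff ℝ ∞ f) (h0 : MemLp f 2 (volume : Measure E3))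
    (h1 : MemLp (∇ f) 2 (volume : Measure E3)) : grad (ofSmooth f hf h0 h1) =ᵐ[volume] ∇ f :=
  h1.coeFn_toLp

theorem memLp_gradient {f : E3 → ℝ} (hf : ContDiff ℝ ∞ f) (hc : HasCompactSupport f) :
    MemLp (∇ f) 2 (volume : Measure E3) :=
  (continuous_gradient hf).memLp_of_hasCompactSupport (HasCompactSupport.gradient hc)

theorem grad_ae_eq_gradient {u : H1} {f : E3 → ℝ} (hf : ContDiff ℝ ∞ f) (hc : HasCompactSupport f)
    (h : toFun u =ᵐ[volume] f) : grad u =ᵐ[volume] ∇ f :=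
  ((isWeakGradient_grad u).congr_ae h (ae_eq_refl _)).ae_eq (isWeakGradient_gradient hf)
    (grad_memLp u) (memLp_gradient hf hc)

theorem exists_bound_of_test {η : E3 → ℝ} (hη : ContDiff ℝ ∞ η) (hc : HasCompactSupport η) :
    ∃ C, 0 ≤ C ∧ (∀ y, |η y| ≤ C) ∧ ∀ y, ‖∇ η y‖ ≤ C := by
  obtain ⟨C, hC⟩ := hη.continuous.bounded_above_of_compact_support hc
  obtain ⟨D, hD⟩ :=
    (continuous_gradient hη).bounded_above_of_compact_support (HasCompactSupport.gradient hc)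
  exact ⟨max C D, (norm_nonneg _).trans ((hC 0).trans (le_max_left _ _)),
    fun y => (hC y).trans (le_max_left _ _), fun y => (hD y).trans (le_max_right _ _)⟩

/-! ### Multiplication by test functions as a bounded operator on H¹ -/

section Multiplication

theorem memLp_bdd_mul {η : E3 → ℝ} (hη : ContDiff ℝ ∞ η) (hc : HasCompactSupport η)
    {u : E3 → ℝ} (hu : MemLp u 2 (volume : Measure E3)) :
    MemLp (fun y => η y * u y) 2 (volume : Measure E3) := by
  obtain ⟨C, -, h1, -⟩ := exists_bound_of_test hη hc
  refine hu.of_le_mul (c := C) (hη.continuous.aestronglyMeasurable.mul hu.1)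
    (Eventually.of_forall fun y => ?_)
  rw [norm_mul]
  exact mul_le_mul_of_nonneg_right (h1 y) (norm_nonneg _)

theorem memLp_bdd_smul_add {η : E3 → ℝ} (hη : ContDiff ℝ ∞ η) (hc : HasCompactSupport η)
    {u : E3 → ℝ} {g : E3 → E3} (hu : MemLp u 2 (volume : Measure E3))
    (hg : MemLp g 2 (volume : Measure E3)) :
    MemLp (fun y => η y • g y + u y • ∇ η y) 2 (volume : Measure E3) := by
  obtain ⟨C, -, h1, h2⟩ := exists_bound_of_test hη hc
  refine MemLp.add (hg.of_le_mul (c := C) (hη.continuous.aestronglyMeasurable.smul hg.1)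
    (Eventually.of_forall fun y => ?_)) (hu.of_le_mul (c := C)
      (hu.1.smul (continuous_gradient hη).aestronglyMeasurable) (Eventually.of_forall fun y => ?_))
  · rw [norm_smul]
    exact mul_le_mul_of_nonneg_right (h1 y) (norm_nonneg _)
  · rw [norm_smul, mul_comm]
    exact mul_le_mul_of_nonneg_right (h2 y) (norm_nonneg _)

/-- Multiplication of an element of `H¹(ℝ³)` by a test function. -/
def mulFun {η : E3 → ℝ} (hη : ContDiff ℝ ∞ η) (hc : HasCompactSupport η)
    (u : H1) : H1 :=
  mkH1 ((memLp_bdd_mul hη hc (toFun_memLp u)).toLp _)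
    ((memLp_bdd_smul_add hη hc (toFun_memLp u) (grad_memLp u)).toLp _)
    (((isWeakGradient_grad u).mul (toFun_memLp u) (grad_memLp u) hη).congr_ae
      (MemLp.coeFn_toLp _).symm (MemLp.coeFn_toLp _).symm)

theorem toFun_mulFun {η : E3 → ℝ} (hη : ContDiff ℝ ∞ η) (hc : HasCompactSupport η)
    (u : H1) : toFun (mulFun hη hc u) =ᵐ[volume] fun y => η y * toFun u y :=
  (memLp_bdd_mul hη hc (toFun_memLp u)).coeFn_toLp

theorem grad_mulFun {η : E3 → ℝ} (hη : ContDiff ℝ ∞ η) (hc : HasCompactSupport η)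
    (u : H1) :
    grad (mulFun hη hc u) =ᵐ[volume] fun y => η y • grad u y + toFun u y • ∇ η y :=
  (memLp_bdd_smul_add hη hc (toFun_memLp u) (grad_memLp u)).coeFn_toLp

/-- Multiplication by a test function, as a bounded operator on `H¹(ℝ³)`. -/
def mulL {η : E3 → ℝ} (hη : ContDiff ℝ ∞ η) (hc : HasCompactSupport η) :
    H1 →L[ℝ] H1 :=
  LinearMap.mkContinuousOfExistsBound
    { toFun := mulFun hη hc
      map_add' := fun u v => by
        refine H1_ext (Lp.ext ?_)
        rw [map_add toFun]
        filter_upwards [toFun_mulFun hη hc (u + v), toFun_mulFun hη hc u, toFun_mulFun hη hc v,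
          Lp.coeFn_add (toFun (mulFun hη hc u)) (toFun (mulFun hη hc v)),
          Lp.coeFn_add (toFun u) (toFun v)] with y h1 h2 h3 h4 h5
        rw [map_add toFun] at h1
        rw [h1, h4, h5, Pi.add_apply, Pi.add_apply, h2, h3, mul_add]
      map_smul' := fun c u => by
        refine H1_ext (Lp.ext ?_)
        rw [RingHom.id_apply, map_smul toFun]
        filter_upwards [toFun_mulFun hη hc (c • u), toFun_mulFun hη hc u,
          Lp.coeFn_smul c (toFun (mulFun hη hc u)),
          Lp.coeFn_smul c (toFun u)] with y h1 h2 h3 h4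
        rw [map_smul toFun] at h1
        rw [h1, h3, h4, Pi.smul_apply, Pi.smul_apply, h2, smul_eq_mul, smul_eq_mul]
        ring }
    (by
      obtain ⟨C, hC, h1, h2⟩ := exists_bound_of_test hη hc
      -- One `C` bounds the function part; the two others bound the two terms of the product rule
      -- for the gradient.
      refine ⟨C + (C + C), fun u => ?_⟩
      have hf : ‖toFun u‖ ≤ ‖u‖ := by
        refine abs_le_of_sq_le_sq' ?_ (norm_nonneg _) |>.2
        rw [norm_sq_H1 u]; nlinarith [sq_nonneg ‖grad u‖]
      have hg : ‖grad u‖ ≤ ‖u‖ := by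
        refine abs_le_of_sq_le_sq' ?_ (norm_nonneg _) |>.2
        rw [norm_sq_H1 u]; nlinarith [sq_nonneg ‖toFun u‖]
      have k1 : ‖toFun (mulFun hη hc u)‖ ≤ C * ‖u‖ := by
        refine (Lp.norm_le_mul_norm_of_ae_le_mul (g := toFun u) ?_).trans
          (mul_le_mul_of_nonneg_left hf hC)
        filter_upwards [toFun_mulFun hη hc u] with y hy
        rw [hy, norm_mul]
        exact mul_le_mul_of_nonneg_right (h1 y) (norm_nonneg _)
      have k2 : ‖grad (mulFun hη hc u)‖ ≤ C * ‖u‖ + C * ‖u‖ := by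
        have m1 : MemLp (fun y => η y • grad u y) 2 (volume : Measure E3) :=
          (grad_memLp u).of_le_mul (c := C)
            (hη.continuous.aestronglyMeasurable.smul (grad_memLp u).1)
            (Eventually.of_forall fun y => by
              rw [norm_smul]; exact mul_le_mul_of_nonneg_right (h1 y) (norm_nonneg _))
        have m2 : MemLp (fun y => toFun u y • ∇ η y) 2 (volume : Measure E3) :=
          (toFun_memLp u).of_le_mul (c := C)
            ((toFun_memLp u).1.smul (continuous_gradient hη).aestronglyMeasurable)
            (Eventually.of_forall fun y => by
              rw [norm_smul, mul_comm]; exact mul_le_mul_of_nonneg_right (h2 y) (norm_nonneg _))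
        have e : grad (mulFun hη hc u) = m1.toLp _ + m2.toLp _ := by
          refine Lp.ext ?_
          filter_upwards [grad_mulFun hη hc u, Lp.coeFn_add (m1.toLp _) (m2.toLp _),
            m1.coeFn_toLp, m2.coeFn_toLp] with y a1 a2 a3 a4
          rw [a1, a2, Pi.add_apply, a3, a4]
        rw [e]
        refine (norm_add_le _ _).trans (add_le_add ?_ ?_)
        · refine (Lp.norm_le_mul_norm_of_ae_le_mul (g := grad u) ?_).trans
            (mul_le_mul_of_nonneg_left hg hC)
          filter_upwards [m1.coeFn_toLp] with y hy
          rw [hy, norm_smul]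
          exact mul_le_mul_of_nonneg_right (h1 y) (norm_nonneg _)
        · refine (Lp.norm_le_mul_norm_of_ae_le_mul (g := toFun u) ?_).trans
            (mul_le_mul_of_nonneg_left hf hC)
          filter_upwards [m2.coeFn_toLp] with y hy
          rw [hy, norm_smul, mul_comm]
          exact mul_le_mul_of_nonneg_right (h2 y) (norm_nonneg _)
      have k3 := norm_sq_H1 (mulFun hη hc u)
      have : ‖mulFun hη hc u‖ ≤ ‖toFun (mulFun hη hc u)‖ + ‖grad (mulFun hη hc u)‖ := by
        refine abs_le_of_sq_le_sq' ?_ (by positivity) |>.2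
        rw [k3]
        nlinarith [norm_nonneg (toFun (mulFun hη hc u)), norm_nonneg (grad (mulFun hη hc u))]
      change ‖mulFun hη hc u‖ ≤ _
      nlinarith)

theorem toFun_mulL {η : E3 → ℝ} (hη : ContDiff ℝ ∞ η) (hc : HasCompactSupport η)
    (u : H1) : toFun (mulL hη hc u) =ᵐ[volume] fun y => η y * toFun u y :=
  toFun_mulFun hη hc u

theorem grad_mulL {η : E3 → ℝ} (hη : ContDiff ℝ ∞ η) (hc : HasCompactSupport η)
    (u : H1) :
    grad (mulL hη hc u) =ᵐ[volume] fun y => η y • grad u y + toFun u y • ∇ η y :=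
  grad_mulFun hη hc u

end Multiplication

/-! ### Norms and the screened form as integrals -/

theorem norm_sq_L2fun (f : L2fun) : ‖f‖ ^ 2 = ∫ y, f y ^ 2 := by
  rw [← real_inner_self_eq_norm_sq, L2.inner_def]
  exact integral_congr_ae (Eventually.of_forall fun y => by simp [sq])

theorem norm_sq_L2vec (g : L2vec) : ‖g‖ ^ 2 = ∫ y, ‖g y‖ ^ 2 := by
  rw [← real_inner_self_eq_norm_sq, L2.inner_def]
  exact integral_congr_ae (Eventually.of_forall fun y => real_inner_self_eq_norm_sq _)

theorem integrable_sq_toFun (u : H1) : Integrable fun y => toFun u y ^ 2 :=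
  (toFun_memLp u).integrable_sq

theorem integrable_sq_grad (u : H1) : Integrable fun y => ‖grad u y‖ ^ 2 :=
  (memLp_two_iff_integrable_sq_norm (grad_memLp u).1).1 (grad_memLp u)

theorem normOn_le_norm (Ω : Set E3) (u : H1) : normOn Ω u ≤ ‖u‖ := by
  refine Real.sqrt_le_iff.2 ⟨norm_nonneg _, ?_⟩
  rw [norm_sq_H1, norm_sq_L2fun, norm_sq_L2vec]
  exact add_le_add
    (setIntegral_le_integral (integrable_sq_toFun u) (Eventually.of_forall fun y => sq_nonneg _))
    (setIntegral_le_integral (integrable_sq_grad u) (Eventually.of_forall fun y => sq_nonneg _))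

theorem screenedForm_self (ξ : ℝ) (u : H1) :
    screenedForm ξ u u = ∫ y, (‖grad u y‖ ^ 2 + (ξ ^ 2)⁻¹ * toFun u y ^ 2) := by
  rw [screenedForm_apply, real_inner_self_eq_norm_sq, real_inner_self_eq_norm_sq, norm_sq_L2fun,
    norm_sq_L2vec, integral_add (integrable_sq_grad u) ((integrable_sq_toFun u).const_mul _),
    integral_const_mul]

theorem screenedForm_symm (ξ : ℝ) (u v : H1) : screenedForm ξ u v = screenedForm ξ v u := by
  rw [screenedForm_apply, screenedForm_apply, real_inner_comm, real_inner_comm (toFun u)]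

theorem screenedForm_nonneg (ξ : ℝ) (u : H1) : 0 ≤ screenedForm ξ u u := by
  rw [screenedForm_self]
  positivity

/-! ### Rescaled cutoff functions -/

section Cutoff

/-- The bump function `b` centred at `x` and rescaled by `r`. -/
def cutoff (b : ContDiffBump (0 : E3)) (x : E3) (r : ℝ) : E3 → ℝ := fun y => b (r⁻¹ • (y - x))

variable (b : ContDiffBump (0 : E3)) (x : E3) {r : ℝ}

theorem contDiff_cutoff (r : ℝ) : ContDiff ℝ ∞ (cutoff b x r) :=
  b.contDiff.comp ((contDiff_id.sub contDiff_const).const_smul r⁻¹)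

theorem cutoff_nonneg (r : ℝ) (y : E3) : 0 ≤ cutoff b x r y := b.nonneg

theorem cutoff_le_one (r : ℝ) (y : E3) : cutoff b x r y ≤ 1 := b.le_one

theorem norm_inv_smul (hr : 0 < r) (y : E3) : ‖r⁻¹ • (y - x)‖ = r⁻¹ * dist y x := by
  rw [norm_smul, Real.norm_of_nonneg (inv_nonneg.2 hr.le), dist_eq_norm]

theorem cutoff_eq_one (hr : 0 < r) {y : E3} (hy : dist y x ≤ r * b.rIn) : cutoff b x r y = 1 := by
  refine b.one_of_mem_closedBall ?_
  rw [mem_closedBall_zero_iff, norm_inv_smul x hr, inv_mul_le_iff₀ hr]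
  exact hy

theorem cutoff_eq_zero (hr : 0 < r) {y : E3} (hy : r * b.rOut ≤ dist y x) :
    cutoff b x r y = 0 := by
  refine b.zero_of_le_dist ?_
  rw [dist_zero_right, norm_inv_smul x hr, le_inv_mul_iff₀ hr]
  exact hy

theorem hasCompactSupport_cutoff (hr : 0 < r) : HasCompactSupport (cutoff b x r) := by
  refine HasCompactSupport.intro (isCompact_closedBall x (r * b.rOut)) fun y hy => ?_
  exact cutoff_eq_zero b x hr (le_of_lt (by simpa using hy))

/-- The values 1 and 0 are the extreme values of the cutoff, so its gradient vanishes wherever they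
are attained, including on the boundary of the plateau and of the support. -/
theorem gradient_cutoff_of_eq_one {r : ℝ} {y : E3} (hy : cutoff b x r y = 1) :
    ∇ (cutoff b x r) y = 0 := by
  have : IsLocalMax (cutoff b x r) y :=
    Eventually.of_forall fun z => by rw [hy]; exact cutoff_le_one b x r z
  simp [gradient, this.fderiv_eq_zero]

theorem gradient_cutoff_of_eq_zero {r : ℝ} {y : E3} (hy : cutoff b x r y = 0) :
    ∇ (cutoff b x r) y = 0 := by
  have : IsLocalMin (cutoff b x r) y :=
    Eventually.of_forall fun z => by rw [hy]; exact cutoff_nonneg b x r z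
  simp [gradient, this.fderiv_eq_zero]

/-- A bound for the gradient of a bump function. -/
theorem exists_bumpConst : ∃ C, 0 ≤ C ∧ ∀ y, ‖fderiv ℝ b y‖ ≤ C := by
  obtain ⟨D, hD⟩ := (b.contDiff (n := ⊤)).continuous_fderiv (by simp)
    |>.bounded_above_of_compact_support (HasCompactSupport.fderiv (𝕜 := ℝ) b.hasCompactSupport)
  exact ⟨D, (norm_nonneg _).trans (hD 0), hD⟩

theorem norm_gradient_cutoff_le {C : ℝ} (hC : ∀ y, ‖fderiv ℝ b y‖ ≤ C) (hr : 0 < r) (y : E3) :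
    ‖∇ (cutoff b x r) y‖ ≤ C / r := by
  have h1 : HasFDerivAt (fun y : E3 => r⁻¹ • (y - x)) (r⁻¹ • ContinuousLinearMap.id ℝ E3) y :=
    ((hasFDerivAt_id y).sub_const x).const_smul r⁻¹
  have h2 : HasFDerivAt (cutoff b x r)
      ((fderiv ℝ b (r⁻¹ • (y - x))).comp (r⁻¹ • ContinuousLinearMap.id ℝ E3)) y :=
    (((b.contDiff (n := ⊤)).differentiable (by simp)) (r⁻¹ • (y - x))).hasFDerivAt.comp y h1
  have h3 : ‖∇ (cutoff b x r) y‖ = ‖fderiv ℝ (cutoff b x r) y‖ :=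
    (InnerProductSpace.toDual ℝ E3).symm.norm_map _
  rw [h3, h2.fderiv, ContinuousLinearMap.comp_smul, ContinuousLinearMap.comp_id, norm_smul,
    Real.norm_of_nonneg (inv_nonneg.2 hr.le), div_eq_inv_mul]
  exact mul_le_mul_of_nonneg_left (hC _) (inv_nonneg.2 hr.le)

end Cutoff

/-! ### Truncation and integration by parts -/

theorem mulL_mem_testFunctions {η f : E3 → ℝ} (hη : ContDiff ℝ ∞ η) (hc : HasCompactSupport η)
    (hf : ContDiff ℝ ∞ f) {u : H1} (h : toFun u =ᵐ[volume] f) {K : Set E3}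
    (hK : ∀ y ∈ K, η y * f y = 0) : mulL hη hc u ∈ testFunctions K := by
  refine ⟨fun y => η y * f y, hη.mul hf, hc.mul_right, hK, ?_⟩
  filter_upwards [toFun_mulL hη hc u, h] with y h1 h2
  rw [h1, h2]

/-- Truncations of an element of `H¹(ℝ³)` converge to it. -/
theorem tendsto_mulL_cutoff (b : ContDiffBump (0 : E3)) (u : H1) :
    Tendsto (fun n : ℕ => mulL (contDiff_cutoff b 0 (n + 1))
      (hasCompactSupport_cutoff b 0 n.cast_add_one_pos) u) atTop (𝓝 u) := by
  obtain ⟨C, hC, hC'⟩ := exists_bumpConst b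
  rw [tendsto_iff_norm_sub_tendsto_zero]
  set v : ℕ → H1 := fun n => mulL (contDiff_cutoff b 0 (n + 1))
      (hasCompactSupport_cutoff b 0 n.cast_add_one_pos) u - u with hv
  suffices h : Tendsto (fun n => ‖v n‖ ^ 2) atTop (𝓝 0) by
    have := h.sqrt
    simpa [Real.sqrt_sq (norm_nonneg _)] using this
  set χ : ℕ → E3 → ℝ := fun n => cutoff b 0 (n + 1) with hχ
  have e1 : ∀ n, toFun (v n) =ᵐ[volume] fun y => (χ n y - 1) * toFun u y := by
    intro n
    have h1 := toFun_mulL (contDiff_cutoff b 0 (n + 1))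
      (hasCompactSupport_cutoff b 0 n.cast_add_one_pos) u
    have h2 := Lp.coeFn_sub (toFun (mulL (contDiff_cutoff b 0 (n + 1))
      (hasCompactSupport_cutoff b 0 n.cast_add_one_pos) u)) (toFun u)
    rw [← map_sub] at h2
    filter_upwards [h1, h2] with y h1 h2
    rw [hv]
    rw [h2, Pi.sub_apply, h1]
    ring
  have e2 : ∀ n, grad (v n) =ᵐ[volume]
      fun y => (χ n y - 1) • grad u y + toFun u y • ∇ (χ n) y := by
    intro n
    have h1 := grad_mulL (contDiff_cutoff b 0 (n + 1))
      (hasCompactSupport_cutoff b 0 n.cast_add_one_pos) u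
    have h2 := Lp.coeFn_sub (grad (mulL (contDiff_cutoff b 0 (n + 1))
      (hasCompactSupport_cutoff b 0 n.cast_add_one_pos) u)) (grad u)
    rw [← map_sub] at h2
    filter_upwards [h1, h2] with y h1 h2
    rw [hv]
    rw [h2, Pi.sub_apply, h1, sub_smul, one_smul]
    abel
  have e3 : ∀ n, ‖v n‖ ^ 2 = ∫ y, (toFun (v n) y ^ 2 + ‖grad (v n) y‖ ^ 2) := fun n => by
    rw [norm_sq_H1, norm_sq_L2fun, norm_sq_L2vec,
      integral_add (integrable_sq_toFun _) (integrable_sq_grad _)]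
  simp_rw [e3]
  have e0 : (0 : ℝ) = ∫ _ : E3, (0 : ℝ) := by simp
  rw [e0]
  -- The gradients of the cutoffs are bounded by `C / (n + 1) ≤ C`, which gives a dominating
  -- function independent of `n`.
  refine tendsto_integral_of_dominated_convergence
    (fun y => toFun u y ^ 2 + 2 * (‖grad u y‖ ^ 2 + C ^ 2 * toFun u y ^ 2)) ?_ ?_ ?_ ?_
  · exact fun n => ((integrable_sq_toFun _).add (integrable_sq_grad _)).1
  · exact (integrable_sq_toFun u).add
      (((integrable_sq_grad u).add ((integrable_sq_toFun u).const_mul _)).const_mul _)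
  · intro n
    filter_upwards [e1 n, e2 n] with y h1 h2
    rw [Real.norm_of_nonneg (by positivity), h1, h2]
    have a1 : (χ n y - 1) ^ 2 ≤ 1 := by
      have k1 := cutoff_nonneg b 0 (n + 1) y
      have k2 := cutoff_le_one b 0 (n + 1) y
      simp only [hχ]
      nlinarith
    have a2 : ‖∇ (χ n) y‖ ^ 2 ≤ C ^ 2 := by
      refine pow_le_pow_left₀ (norm_nonneg _) ?_ 2
      refine (norm_gradient_cutoff_le b 0 hC' n.cast_add_one_pos y).trans ?_
      exact div_le_self hC (by linarith [n.cast_nonneg (α := ℝ)])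
    have a3 : ‖(χ n y - 1) • grad u y + toFun u y • ∇ (χ n) y‖ ^ 2
        ≤ 2 * (‖(χ n y - 1) • grad u y‖ ^ 2 + ‖toFun u y • ∇ (χ n) y‖ ^ 2) := by
      have := norm_add_le ((χ n y - 1) • grad u y) (toFun u y • ∇ (χ n) y)
      have h3 := pow_le_pow_left₀ (norm_nonneg _) this 2
      refine h3.trans ?_
      nlinarith [sq_nonneg (‖(χ n y - 1) • grad u y‖ - ‖toFun u y • ∇ (χ n) y‖)]
    rw [norm_smul, norm_smul, mul_pow, mul_pow, Real.norm_eq_abs, Real.norm_eq_abs, sq_abs,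
      sq_abs] at a3
    have a4 := mul_le_mul_of_nonneg_right a1 (sq_nonneg ‖grad u y‖)
    have a5 := mul_le_mul_of_nonneg_left a2 (sq_nonneg (toFun u y))
    have a6 := mul_le_mul_of_nonneg_right a1 (sq_nonneg (toFun u y))
    rw [mul_pow]
    nlinarith
  · have h1 := ae_all_iff.2 e1
    have h2 := ae_all_iff.2 e2
    filter_upwards [h1, h2] with y h1 h2
    -- A fixed point eventually lies in the plateau of the cutoff, and from then on the integrand
    -- vanishes there.
    obtain ⟨N, hN⟩ := exists_nat_gt (dist y 0 / b.rIn)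
    refine tendsto_const_nhds.congr' ?_
    filter_upwards [eventually_ge_atTop N] with n hn
    have h3 : χ n y = 1 := by
      refine cutoff_eq_one b 0 n.cast_add_one_pos ?_
      rw [div_lt_iff₀ b.rIn_pos] at hN
      refine hN.le.trans (mul_le_mul_of_nonneg_right ?_ b.rIn_pos.le)
      have : (N : ℝ) ≤ n := by exact_mod_cast hn
      linarith
    rw [h1, h2, h3, gradient_cutoff_of_eq_one b 0 h3]
    simp

/-- A fixed bump function. -/
def unitBump : ContDiffBump (0 : E3) := ⟨1, 2, one_pos, one_lt_two⟩

theorem ofSmooth_mem_H10_empty {f : E3 → ℝ} (hf : ContDiff ℝ ∞ f)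
    (h0 : MemLp f 2 (volume : Measure E3)) (h1 : MemLp (∇ f) 2 (volume : Measure E3)) :
    ofSmooth f hf h0 h1 ∈ H10 ∅ := by
  refine mem_closure_of_tendsto (tendsto_mulL_cutoff unitBump _) (Eventually.of_forall fun n => ?_)
  exact mulL_mem_testFunctions _ _ hf (toFun_ofSmooth hf h0 h1) (by simp)

/-- Integration by parts in `H¹(ℝ³)`. -/
theorem integral_toFun_mul_grad (a : H1) {c : H1} (hc : c ∈ H10 ∅) (i : Fin 3) :
    ∫ y, grad c y i * toFun a y = - ∫ y, toFun c y * grad a y i := by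
  have hcl : IsClosed {c : H1 | ∫ y, grad c y i * toFun a y = - ∫ y, toFun c y * grad a y i} := by
    simp_rw [integral_coord_mul_eq_inner _ (toFun_memLp a) i,
      integral_mul_eq_inner _ (memLp_coord (grad_memLp a) i)]
    exact isClosed_eq (continuous_const.inner grad.continuous)
      (continuous_const.inner toFun.continuous).neg
  refine hcl.closure_subset_iff.2 ?_ hc
  rintro u ⟨φ, hφ, hcs, -, hu⟩
  have hg := grad_ae_eq_gradient hφ hcs hu
  have key := isWeakGradient_grad a φ hφ hcs i
  have e1 : ∫ y, grad u y i * toFun a y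
      = ∫ y, toFun a y * fderiv ℝ φ y (EuclideanSpace.single i 1) :=
    integral_congr_ae (by
      filter_upwards [hg] with y hy
      rw [hy, gradient_apply, mul_comm])
  have e2 : ∫ y, toFun u y * grad a y i = ∫ y, grad a y i * φ y :=
    integral_congr_ae (by
      filter_upwards [hu] with y hy
      rw [hy, mul_comm])
  rw [Set.mem_ofPred_eq, e1, e2, key]

/-! ### Density of test functions by means of the Fourier transform -/

section Schwartz

open SchwartzMap

theorem contDiff_re_schwartz (s : 𝓢(E3, ℂ)) : ContDiff ℝ ∞ fun y => (s y).re :=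
  Complex.reCLM.contDiff.comp (s.smooth ⊤)

theorem gradient_re_schwartz (s : 𝓢(E3, ℂ)) (y : E3) (i : Fin 3) :
    (∇ (fun z => (s z).re) y) i
      = (LineDeriv.lineDerivOp (EuclideanSpace.single i (1 : ℝ) : E3) s y).re := by
  rw [gradient_apply, lineDerivOp_apply_eq_fderiv]
  have := (Complex.reCLM.hasFDerivAt (x := s y)).comp y (s.hasFDerivAt y)
  rw [show (fun z => (s z).re) = Complex.reCLM ∘ s from rfl, this.fderiv]
  rfl

theorem memLp_re_schwartz (s : 𝓢(E3, ℂ)) :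
    MemLp (fun y => (s y).re) 2 (volume : Measure E3) :=
  (s.memLp 2).re

theorem memLp_gradient_re_schwartz (s : 𝓢(E3, ℂ)) :
    MemLp (∇ fun y => (s y).re) 2 (volume : Measure E3) := by
  refine ((fderivCLM ℝ E3 ℂ s).memLp 2).of_le
    (continuous_gradient (contDiff_re_schwartz s)).aestronglyMeasurable
    (Eventually.of_forall fun y => ?_)
  have h3 : ‖∇ (fun z => (s z).re) y‖ = ‖fderiv ℝ (fun z => (s z).re) y‖ :=
    (InnerProductSpace.toDual ℝ E3).symm.norm_map _
  have := (Complex.reCLM.hasFDerivAt (x := s y)).comp y (s.hasFDerivAt y)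
  rw [h3, show (fun z => (s z).re) = Complex.reCLM ∘ s from rfl, this.fderiv]
  refine (ContinuousLinearMap.opNorm_comp_le _ _).trans ?_
  rw [Complex.reCLM_norm, one_mul]
  rfl

/-- The real part of a Schwartz function, as an element of `H¹(ℝ³)`. -/
def ofSchwartz (s : 𝓢(E3, ℂ)) : H1 :=
  ofSmooth (fun y => (s y).re) (contDiff_re_schwartz s) (memLp_re_schwartz s)
    (memLp_gradient_re_schwartz s)

theorem toFun_ofSchwartz (s : 𝓢(E3, ℂ)) : toFun (ofSchwartz s) =ᵐ[volume] fun y => (s y).re :=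
  toFun_ofSmooth _ _ _

theorem grad_ofSchwartz (s : 𝓢(E3, ℂ)) (i : Fin 3) :
    (fun y => grad (ofSchwartz s) y i) =ᵐ[volume]
      toFun (ofSchwartz (LineDeriv.lineDerivOp (EuclideanSpace.single i (1 : ℝ) : E3) s)) := by
  have h := grad_ofSmooth (contDiff_re_schwartz s) (memLp_re_schwartz s)
    (memLp_gradient_re_schwartz s)
  filter_upwards [h, toFun_ofSchwartz
    (LineDeriv.lineDerivOp (EuclideanSpace.single i (1 : ℝ) : E3) s)] with y h1 h2
  rw [h2, ← gradient_re_schwartz, ← h1]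
  rfl

theorem ofSchwartz_mem (s : 𝓢(E3, ℂ)) : ofSchwartz s ∈ H10 ∅ := ofSmooth_mem_H10_empty _ _ _

open Laplacian in
-- Integration by parts in each coordinate moves both derivatives onto the Schwartz function. This
-- is legitimate because its partial derivatives lie in the closure of the test functions, where
-- `integral_toFun_mul_grad` applies.
theorem inner_grad_ofSchwartz (w : H1) (s : 𝓢(E3, ℂ)) :
    inner ℝ (grad w) (grad (ofSchwartz s)) = - ∫ y, toFun w y * (Δ s y).re := by
  have hint : ∀ i : Fin 3, Integrable fun y => toFun w y *
      (LineDeriv.lineDerivOp (EuclideanSpace.single i (1 : ℝ) : E3)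
        (LineDeriv.lineDerivOp (EuclideanSpace.single i (1 : ℝ) : E3) s) y).re := fun i =>
    (toFun_memLp w).integrable_mul (memLp_re_schwartz _)
  have e1 : inner ℝ (grad w) (grad (ofSchwartz s))
      = ∑ i, ∫ y, toFun (ofSchwartz
        (LineDeriv.lineDerivOp (EuclideanSpace.single i (1 : ℝ) : E3) s)) y * grad w y i := by
    rw [L2.inner_def, ← integral_finsetSum]
    · refine integral_congr_ae ?_
      filter_upwards [ae_all_iff.2 (grad_ofSchwartz s)] with y hy
      rw [PiLp.inner_apply]
      refine Finset.sum_congr rfl fun i _ => ?_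
      rw [← hy i]
      simp
    · exact fun i _ => (toFun_memLp _).integrable_mul (memLp_coord (grad_memLp w) i)
  have e2 : ∀ i, ∫ y, toFun (ofSchwartz
        (LineDeriv.lineDerivOp (EuclideanSpace.single i (1 : ℝ) : E3) s)) y * grad w y i
      = - ∫ y, toFun w y * (LineDeriv.lineDerivOp (EuclideanSpace.single i (1 : ℝ) : E3)
        (LineDeriv.lineDerivOp (EuclideanSpace.single i (1 : ℝ) : E3) s) y).re := by
    intro i
    rw [eq_neg_iff_add_eq_zero, ← eq_neg_iff_add_eq_zero.1 (integral_toFun_mul_grad w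
      (ofSchwartz_mem (LineDeriv.lineDerivOp (EuclideanSpace.single i (1 : ℝ) : E3) s)) i),
      add_comm]
    congr 1
    refine integral_congr_ae ?_
    filter_upwards [grad_ofSchwartz
      (LineDeriv.lineDerivOp (EuclideanSpace.single i (1 : ℝ) : E3) s) i, toFun_ofSchwartz
      (LineDeriv.lineDerivOp (EuclideanSpace.single i (1 : ℝ) : E3)
        (LineDeriv.lineDerivOp (EuclideanSpace.single i (1 : ℝ) : E3) s))] with y h1 h2
    rw [h1, h2, mul_comm]
  rw [e1, Finset.sum_congr rfl fun i _ => e2 i, Finset.sum_neg_distrib,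
    ← integral_finsetSum _ fun i _ => hint i]
  congr 1
  refine integral_congr_ae (Eventually.of_forall fun y => ?_)
  simp only
  rw [← Finset.mul_sum, SchwartzMap.laplacian_eq_sum (EuclideanSpace.basisFun (Fin 3) ℝ)]
  simp

open Laplacian Real in
/-- The equation `-Δs + 4π² s = 4π² ψ` is solvable in the Schwartz class. -/
theorem exists_schwartz_solution (ψ : 𝓢(E3, ℂ)) :
    ∃ s : 𝓢(E3, ℂ), (2 * π) ^ 2 • s - Δ s = (2 * π) ^ 2 • ψ := by
  have hg : (fun x : E3 => (1 + ‖x‖ ^ 2) ^ (-1 : ℝ)).HasTemperateGrowth := by fun_prop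
  have hq : (fun x : E3 => ‖x‖ ^ 2).HasTemperateGrowth := by fun_prop
  -- The Laplacian has the symbol -(2π)²|x|², so the equation reads (1 + |x|²) ŝ = ψ̂ after division
  -- by (2π)².
  refine ⟨fourierMultiplierCLM ℂ (fun x : E3 => (1 + ‖x‖ ^ 2) ^ (-1 : ℝ)) ψ, ?_⟩
  rw [laplacian_eq_fourierMultiplierCLM, neg_smul, sub_neg_eq_add, ← smul_add]
  congr 1
  rw [show ((‖·‖ ^ 2 : E3 → ℝ)) = fun x : E3 => ‖x‖ ^ 2 from rfl,
    fourierMultiplierCLM_fourierMultiplierCLM_apply hq hg]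
  have hadd := fourierMultiplierCLM_sum (F := ℂ) (𝕜 := ℝ) (s := (Finset.univ : Finset Bool))
    -- Additivity in the symbol is obtained from the rule for finite sums, with `Bool` indexing the
    -- two summands.
    (g := fun c x => bif c then (1 + ‖x‖ ^ 2 : ℝ) ^ (-1 : ℝ)
      else ‖x‖ ^ 2 * (1 + ‖x‖ ^ 2 : ℝ) ^ (-1 : ℝ)) (E := E3) (by
        intro c _
        cases c
        · exact hq.mul hg
        · exact hg)
  have h2 := congrArg (fun T : 𝓢(E3, ℂ) →L[ℝ] 𝓢(E3, ℂ) => T ψ) hadd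
  simp only [Fintype.sum_bool, cond_true, cond_false, add_apply] at h2
  refine Eq.trans h2.symm ?_
  have h3 : (fun x : E3 => (1 + ‖x‖ ^ 2 : ℝ) ^ (-1 : ℝ) + ‖x‖ ^ 2 * (1 + ‖x‖ ^ 2 : ℝ) ^ (-1 : ℝ))
      = fun _ => 1 := by
    ext x
    have : (1 + ‖x‖ ^ 2 : ℝ) ≠ 0 := by positivity
    rw [Real.rpow_neg_one]
    field_simp
  rw [h3, fourierMultiplierCLM_const]
  simp

end Schwartz

open Laplacian Real in
/-- Test functions are dense in `H¹(ℝ³)`. -/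
theorem H10_empty : H10 ∅ = ⊤ := by
  rw [eq_top_iff]
  intro u _
  -- The space `H10 ∅` does not involve a screening length, so one may be chosen freely: this value
  -- makes the form match the equation of `exists_schwartz_solution`. The component `w` of `u`
  -- orthogonal to `H10 ∅` is then shown to vanish as a distribution.
  have hξ : (0 : ℝ) < (2 * π)⁻¹ := by positivity
  have hcl := isClosed_H10 ∅
  set p := weakSolution (2 * π)⁻¹ (H10 ∅) (screenedForm (2 * π)⁻¹ u) with hp
  obtain ⟨hpm, hpe⟩ := weakSolution_spec hξ hcl (screenedForm (2 * π)⁻¹ u)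
  rw [← hp] at hpm hpe
  set w := u - p with hw
  suffices h : w = 0 by rw [sub_eq_zero.1 h]; exact hpm
  have hB : ∀ v ∈ H10 ∅, screenedForm (2 * π)⁻¹ w v = 0 := fun v hv => by
    rw [hw, map_sub, sub_apply, hpe v hv, sub_self]
  refine H1_ext (Lp.ext ?_)
  rw [map_zero]
  refine EventuallyEq.trans ?_ (Lp.coeFn_zero ℝ 2 volume).symm
  refine ae_eq_zero_of_integral_contDiff_smul_eq_zero
    ((toFun_memLp w).locallyIntegrable (by norm_num)) fun φ hφ hc => ?_
  have hφ' : ContDiff ℝ ∞ fun y => (φ y : ℂ) := Complex.ofRealCLM.contDiff.comp hφ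
  have hc' : HasCompactSupport fun y => (φ y : ℂ) := hc.comp_left (g := ((↑) : ℝ → ℂ)) rfl
  obtain ⟨s, hs⟩ := exists_schwartz_solution (hc'.toSchwartzMap hφ')
  have h0 := hB _ (ofSchwartz_mem s)
  have hin : inner ℝ (toFun w) (toFun (ofSchwartz s)) = ∫ y, toFun w y * (s y).re := by
    rw [L2.inner_def]
    refine integral_congr_ae ?_
    filter_upwards [toFun_ofSchwartz s] with y hy
    rw [hy]
    simp [mul_comm]
  rw [screenedForm_apply, inner_grad_ofSchwartz, hin, inv_pow, inv_inv] at h0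
  have i1 : Integrable fun y => toFun w y * (Δ s y).re :=
    (toFun_memLp w).integrable_mul (memLp_re_schwartz _)
  have i2 : Integrable fun y => toFun w y * (s y).re :=
    (toFun_memLp w).integrable_mul (memLp_re_schwartz _)
  have e : ∀ y, (2 * π) ^ 2 * (φ y • toFun w y)
      = (2 * π) ^ 2 * (toFun w y * (s y).re) - toFun w y * (Δ s y).re := by
    intro y
    have h1 : (2 * π) ^ 2 • s y - Δ s y = (2 * π) ^ 2 • (φ y : ℂ) :=
      congrArg (fun t : SchwartzMap E3 ℂ => t y) hs
    have h2 := congrArg Complex.re h1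
    rw [Complex.sub_re, Complex.real_smul, Complex.real_smul, Complex.re_ofReal_mul,
      Complex.re_ofReal_mul, Complex.ofReal_re] at h2
    rw [smul_eq_mul]
    linear_combination (-toFun w y) * h2
  have h1 : (2 * π) ^ 2 * ∫ y, φ y • toFun w y = 0 := by
    rw [← integral_const_mul]
    simp_rw [e]
    rw [integral_sub (i2.const_mul _) i1, integral_const_mul]
    linarith
  exact (mul_eq_zero.1 h1).resolve_left (by positivity)

/-! ### The vector field behind the Hardy inequality -/

section VectorField

/-- The regularised distance `√(|y - x|² + a²)`. -/
def regDist (x : E3) (a : ℝ) (y : E3) : ℝ := √(‖y - x‖ ^ 2 + a ^ 2)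

variable (x : E3) {a : ℝ}

theorem regDist_sq (a : ℝ) (y : E3) : regDist x a y ^ 2 = ‖y - x‖ ^ 2 + a ^ 2 :=
  Real.sq_sqrt (by positivity)

theorem regDist_pos (ha : 0 < a) (y : E3) : 0 < regDist x a y := Real.sqrt_pos.2 (by positivity)

theorem contDiff_regDist (ha : 0 < a) : ContDiff ℝ ∞ (regDist x a) :=
  (((contDiff_id.sub contDiff_const).norm_sq ℝ).add contDiff_const).sqrt fun y => by positivity

theorem hasFDerivAt_regDist (ha : 0 < a) (y : E3) :
    HasFDerivAt (regDist x a) ((regDist x a y)⁻¹ • innerSL ℝ (y - x)) y := by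
  have h1 : HasFDerivAt (fun y : E3 => ‖y - x‖ ^ 2 + a ^ 2) ((2 : ℝ) • innerSL ℝ (y - x)) y := by
    have := (((hasFDerivAt_id y).sub_const x).norm_sq).add_const (a ^ 2)
    refine this.congr_fderiv ?_
    ext v
    simp
  refine (h1.sqrt (by positivity)).congr_fderiv ?_
  ext v
  simp [regDist]
  ring

/-- The vector field `-∇w / w` for the superharmonic function `w = 1 + a / √(|y - x|² + a²)`. -/
def hardyField (x : E3) (a : ℝ) (i : Fin 3) (y : E3) : ℝ :=
  a * (y i - x i) / (regDist x a y ^ 3 + a * regDist x a y ^ 2)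

theorem contDiff_hardyField (ha : 0 < a) (i : Fin 3) : ContDiff ℝ ∞ (hardyField x a i) := by
  have h := contDiff_regDist x ha
  refine ContDiff.div (contDiff_const.mul ((contDiff_piLp_apply 2).sub contDiff_const))
    ((h.pow 3).add (contDiff_const.mul (h.pow 2))) fun y => ?_
  have := regDist_pos x ha y
  positivity

theorem fderiv_hardyField (ha : 0 < a) (i : Fin 3) (y : E3) :
    fderiv ℝ (hardyField x a i) y (EuclideanSpace.single i 1) =
      a * ((regDist x a y ^ 3 + a * regDist x a y ^ 2)
        - (y i - x i) ^ 2 * (3 * regDist x a y + 2 * a))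
        / (regDist x a y ^ 3 + a * regDist x a y ^ 2) ^ 2 := by
  have hs := regDist_pos x ha y
  have h := hasFDerivAt_regDist x ha y
  have hline : HasDerivAt (fun t : ℝ => y + t • (EuclideanSpace.single i 1 : E3))
      (EuclideanSpace.single i 1) 0 := by
    simpa using ((hasDerivAt_id (0 : ℝ)).smul_const (EuclideanSpace.single i 1 : E3)).const_add y
  have hs' : HasDerivAt (fun t : ℝ => regDist x a (y + t • (EuclideanSpace.single i 1 : E3)))
      ((regDist x a y)⁻¹ * (y i - x i)) 0 := by
    have h0 : HasFDerivAt (regDist x a) ((regDist x a y)⁻¹ • innerSL ℝ (y - x))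
      (y + (0 : ℝ) • (EuclideanSpace.single i 1 : E3)) := by simpa using h
    have := h0.comp_hasDerivAt (0 : ℝ) hline
    refine this.congr_deriv ?_
    simp [EuclideanSpace.inner_single_right]
  have hnum : HasDerivAt
      (fun t : ℝ => a * ((y + t • (EuclideanSpace.single i 1 : E3)) i - x i)) a 0 := by
    have : HasDerivAt (fun t : ℝ => a * (y i + t - x i)) a 0 := by
      simpa using (((hasDerivAt_id (0 : ℝ)).const_add (y i)).sub_const (x i)).const_mul a
    simpa using this
  have hden := (hs'.pow 3).add ((hs'.pow 2).const_mul a)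
  have hF := hnum.div hden (by simp; positivity)
  have hc := (((contDiff_hardyField x ha i).differentiable (by simp)) y).hasFDerivAt
  have hc0 : HasFDerivAt (hardyField x a i) (fderiv ℝ (hardyField x a i) y)
    (y + (0 : ℝ) • (EuclideanSpace.single i 1 : E3)) := by simpa using hc
  have hc1 := hc0.comp_hasDerivAt (0 : ℝ) hline
  have := hc1.unique hF
  rw [this]
  simp
  field_simp

theorem sum_sq_coord (y : E3) : ∑ i, (y i - x i) ^ 2 = ‖y - x‖ ^ 2 := by
  rw [EuclideanSpace.norm_sq_eq]
  simp

/-- The divergence of the vector field `hardyField`. -/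
theorem div_hardyField (ha : 0 < a) (y : E3) :
    ∑ i, fderiv ℝ (hardyField x a i) y (EuclideanSpace.single i 1) =
      ∑ i, hardyField x a i y ^ 2 + 3 * a ^ 3 / (regDist x a y ^ 4 * (regDist x a y + a)) := by
  have hs := regDist_pos x ha y
  have hq := regDist_sq x a y
  have e : ‖y - x‖ ^ 2 = regDist x a y ^ 2 - a ^ 2 := by linarith
  simp_rw [fderiv_hardyField x ha, hardyField, div_pow, mul_pow]
  rw [← Finset.sum_div, ← Finset.sum_div, ← Finset.mul_sum, ← Finset.mul_sum,
    Finset.sum_sub_distrib, ← Finset.sum_mul, sum_sq_coord, e]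
  set s := regDist x a y
  simp
  field_simp
  ring

/-- The field decays like `a / |y - x|²`, as the gradient of a Coulomb potential. With a cutoff
gradient of order `1/R` this produces the capacity density `r / R³`. -/
theorem sum_hardyField_sq_le (ha : 0 < a) {y : E3} (hy : y ≠ x) :
    ∑ i, hardyField x a i y ^ 2 ≤ (a / ‖y - x‖ ^ 2) ^ 2 := by
  have hs := regDist_pos x ha y
  have hq := regDist_sq x a y
  have hρ : 0 < ‖y - x‖ := norm_pos_iff.2 (sub_ne_zero.2 hy)
  simp_rw [hardyField, div_pow, mul_pow]
  rw [← Finset.sum_div, ← Finset.mul_sum, sum_sq_coord]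
  have h1 : ‖y - x‖ ≤ regDist x a y := by
    refine abs_le_of_sq_le_sq' ?_ hs.le |>.2
    rw [hq]; nlinarith
  have h2 : ‖y - x‖ ^ 3 ≤ regDist x a y ^ 3 + a * regDist x a y ^ 2 :=
    (pow_le_pow_left₀ hρ.le h1 3).trans (by have : 0 ≤ a * regDist x a y ^ 2 := by positivity
                                            linarith)
  have h3 := pow_le_pow_left₀ (by positivity) h2 2
  rw [div_le_div_iff₀ (by positivity) (by positivity)]
  calc a ^ 2 * ‖y - x‖ ^ 2 * (‖y - x‖ ^ 2) ^ 2 = a ^ 2 * (‖y - x‖ ^ 3) ^ 2 := by ring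
    _ ≤ _ := mul_le_mul_of_nonneg_left h3 (by positivity)

theorem integrable_fderiv_mul {f g : E3 → ℝ} (hf : ContDiff ℝ ∞ f) (hc : HasCompactSupport f)
    (hg : ContDiff ℝ ∞ g) (v : E3) : Integrable fun y => fderiv ℝ f y v * g y :=
  (((hf.continuous_fderiv (by simp)).clm_apply continuous_const).mul
    hg.continuous).integrable_of_hasCompactSupport (hc.fderiv_apply (𝕜 := ℝ) v).mul_right

theorem integrable_mul_fderiv {f g : E3 → ℝ} (hf : ContDiff ℝ ∞ f) (hc : HasCompactSupport f)
    (hg : ContDiff ℝ ∞ g) (v : E3) : Integrable fun y => f y * fderiv ℝ g y v :=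
  (hf.continuous.mul ((hg.continuous_fderiv (by simp)).clm_apply
    continuous_const)).integrable_of_hasCompactSupport hc.mul_right

/-- The divergence theorem for `ψ • hardyField`. -/
theorem integral_div_hardyField (ha : 0 < a) {ψ : E3 → ℝ} (hψ : ContDiff ℝ ∞ ψ)
    (hc : HasCompactSupport ψ) :
    Integrable (fun y => ∑ i, (ψ y * fderiv ℝ (hardyField x a i) y (EuclideanSpace.single i 1)
      + fderiv ℝ ψ y (EuclideanSpace.single i 1) * hardyField x a i y)) ∧
    ∫ y, ∑ i, (ψ y * fderiv ℝ (hardyField x a i) y (EuclideanSpace.single i 1)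
      + fderiv ℝ ψ y (EuclideanSpace.single i 1) * hardyField x a i y) = 0 := by
  have h1 := fun i => integrable_mul_fderiv hψ hc (contDiff_hardyField x ha i)
    (EuclideanSpace.single i 1)
  have h2 := fun i => integrable_fderiv_mul hψ hc (contDiff_hardyField x ha i)
    (EuclideanSpace.single i 1)
  refine ⟨integrable_finsetSum _ fun i _ => (h1 i).add (h2 i), ?_⟩
  have h3 : ∀ i ∈ Finset.univ, Integrable fun y =>
      ψ y * fderiv ℝ (hardyField x a i) y (EuclideanSpace.single i 1)
        + fderiv ℝ ψ y (EuclideanSpace.single i 1) * hardyField x a i y :=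
    fun i _ => (h1 i).add (h2 i)
  rw [integral_finsetSum _ h3]
  refine Finset.sum_eq_zero fun i _ => ?_
  rw [integral_add (h1 i) (h2 i), integral_mul_fderiv_eq_neg_fderiv_mul_of_integrable (h2 i) (h1 i)
    ((hψ.continuous.mul (contDiff_hardyField x ha i).continuous).integrable_of_hasCompactSupport
      hc.mul_right) (fun y _ => (hψ.differentiable (by simp)) y)
    (fun y _ => ((contDiff_hardyField x ha i).differentiable (by simp)) y), neg_add_cancel]

end VectorField

/-! ### Local Hardy inequality and localisation of the energy -/

theorem norm_sq_eq_sum_coord (v : E3) : ‖v‖ ^ 2 = ∑ i, v i ^ 2 := by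
  rw [EuclideanSpace.norm_sq_eq]; simp

/-- A local Hardy inequality with the sharp dependence on the outer radius. -/
theorem exists_local_hardy {κ : ℝ} (hκ : 1 < κ) : ∃ C : ℝ, 0 ≤ C ∧ ∀ (x : E3) (r R : ℝ),
    0 < r → κ * r < R → ∀ φ : E3 → ℝ, ContDiff ℝ ∞ φ → HasCompactSupport φ →
      (r ^ 2)⁻¹ * ∫ y in Metric.closedBall x ((1 + κ) / 2 * r), φ y ^ 2
        ≤ C * ∫ y in Metric.ball x R, (‖∇ φ y‖ ^ 2 + r / R ^ 3 * φ y ^ 2) := by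
  have hκ0 : 0 < κ := by linarith
  -- Since `κ * lam = (1 + κ) / 2` and `κ * r < R`, the ball of radius `(1 + κ) / 2 * r` lies in the
  -- plateau of the cutoff `θ`, of radius `lam * R`.
  set lam : ℝ := (1 + κ) / (2 * κ) with hlam
  have hlam0 : 0 < lam := by positivity
  have hlam1 : lam < 1 := by rw [hlam, div_lt_one (by positivity)]; linarith
  set b : ContDiffBump (0 : E3) := ⟨lam, 1, hlam0, hlam1⟩ with hb
  obtain ⟨D, hD, hD'⟩ := exists_bumpConst b
  set κ' : ℝ := (1 + κ) / 2 with hκ'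
  have hκ'0 : 0 < κ' := by positivity
  -- On the inner ball the regularised distance is at most `(1 + κ') * r`; inserting this value in
  -- the weight of `div_hardyField` gives exactly `c / r²`.
  set c : ℝ := 3 / ((1 + κ') ^ 4 * (2 + κ')) with hc
  have hc0 : 0 < c := by positivity
  refine ⟨c⁻¹ * max 1 (D / lam ^ 2), by positivity, fun x r R hr hR φ hφ hcs => ?_⟩
  have hR0 : 0 < R := lt_trans (by positivity) hR
  set θ := cutoff b x R with hθ
  have hθs : ContDiff ℝ ∞ θ := contDiff_cutoff b x R
  have hφ2 : ContDiff ℝ ∞ fun y => φ y * φ y := hφ.mul hφ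
  set ψ : E3 → ℝ := fun y => θ y * (φ y * φ y) with hψ
  have hψs : ContDiff ℝ ∞ ψ := hθs.mul hφ2
  have hψc : HasCompactSupport ψ := (hcs.mul_left).mul_left
  obtain ⟨hint, hzero⟩ := integral_div_hardyField x hr hψs hψc
  have hder : ∀ y i, fderiv ℝ ψ y (EuclideanSpace.single i 1)
      = 2 * θ y * φ y * (∇ φ y) i + φ y ^ 2 * (∇ θ y) i := by
    intro y i
    rw [← gradient_apply, hψ, gradient_mul ((hθs.differentiable (by simp)) y)
      ((hφ2.differentiable (by simp)) y), gradient_mul ((hφ.differentiable (by simp)) y)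
      ((hφ.differentiable (by simp)) y)]
    simp only [PiLp.add_apply, PiLp.smul_apply, smul_eq_mul]
    ring
  set V : E3 → ℝ := fun y => ∑ i,
    (ψ y * fderiv ℝ (hardyField x r i) y (EuclideanSpace.single i 1)
      + fderiv ℝ ψ y (EuclideanSpace.single i 1) * hardyField x r i y) with hV
  -- The term |F|² in the divergence of the field F completes the square |φF + ∇φ|², at the cost of
  -- -|∇φ|². The square is dropped.
  have hVlow : ∀ y, θ y * φ y ^ 2 * (3 * r ^ 3 / (regDist x r y ^ 4 * (regDist x r y + r)))
      - θ y * ‖∇ φ y‖ ^ 2 + φ y ^ 2 * ∑ i, (∇ θ y) i * hardyField x r i y ≤ V y := by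
    intro y
    have hθ0 : 0 ≤ θ y := cutoff_nonneg b x R y
    have e : V y = θ y * φ y ^ 2 * (3 * r ^ 3 / (regDist x r y ^ 4 * (regDist x r y + r)))
        - θ y * ‖∇ φ y‖ ^ 2 + φ y ^ 2 * ∑ i, (∇ θ y) i * hardyField x r i y
        + θ y * ∑ i, (φ y * hardyField x r i y + (∇ φ y) i) ^ 2 := by
      simp only [hV]
      rw [Finset.sum_add_distrib, ← Finset.mul_sum, div_hardyField x hr, norm_sq_eq_sum_coord]
      simp_rw [hder]
      simp only [Fin.sum_univ_three, hψ]
      ring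
    rw [e]
    have : 0 ≤ θ y * ∑ i, (φ y * hardyField x r i y + (∇ φ y) i) ^ 2 :=
      mul_nonneg hθ0 (Finset.sum_nonneg fun i _ => sq_nonneg _)
    linarith
  have hA_R : κ' * r ≤ R * lam := by
    have : κ' = κ * lam := by rw [hκ', hlam]; field_simp
    rw [this]
    nlinarith
  -- The gradient of `θ` vanishes for |y - x| ≤ `R * lam`; elsewhere it is at most `D / R` and the
  -- field at most `r / (R * lam)²`.
  have hTF : ∀ y, -(D / lam ^ 2 * (r / R ^ 3)) ≤ ∑ i, (∇ θ y) i * hardyField x r i y := by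
    intro y
    have hnn : 0 ≤ D / lam ^ 2 * (r / R ^ 3) := by positivity
    by_cases hy : dist y x ≤ R * lam
    · have : ∇ θ y = 0 := gradient_cutoff_of_eq_one b x (cutoff_eq_one b x hR0 hy)
      simp [this, hnn]
    · push Not at hy
      have hpos : 0 < R * lam := by positivity
      have hyx : y ≠ x := by
        rintro rfl
        rw [dist_self] at hy
        linarith
      have h1 : ∑ i, (∇ θ y) i ^ 2 ≤ (D / R) ^ 2 := by
        rw [← norm_sq_eq_sum_coord]
        exact pow_le_pow_left₀ (norm_nonneg _) (norm_gradient_cutoff_le b x hD' hR0 y) 2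
      have h2 := sum_hardyField_sq_le x hr hyx
      have h3 : (r / ‖y - x‖ ^ 2) ^ 2 ≤ (r / (R * lam) ^ 2) ^ 2 := by
        rw [dist_eq_norm] at hy
        gcongr
      have h4 := Finset.sum_mul_sq_le_sq_mul_sq Finset.univ (fun i => (∇ θ y) i)
        (fun i => hardyField x r i y)
      have h5 : (∑ i, (∇ θ y) i * hardyField x r i y) ^ 2 ≤ (D / lam ^ 2 * (r / R ^ 3)) ^ 2 := by
        refine h4.trans ((mul_le_mul h1 (h2.trans h3) (Finset.sum_nonneg fun i _ => sq_nonneg _)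
          (sq_nonneg _)).trans (le_of_eq ?_))
        field_simp
      exact (abs_le_of_sq_le_sq' h5 hnn).1
  -- A pointwise form of the inequality: `V` is a divergence of compact support, so its integral
  -- vanishes.
  have hpt : ∀ y, (Metric.closedBall x (κ' * r)).indicator (fun y => c * (r ^ 2)⁻¹ * φ y ^ 2) y
      ≤ V y + (Metric.ball x R).indicator
        (fun y => max 1 (D / lam ^ 2) * (‖∇ φ y‖ ^ 2 + r / R ^ 3 * φ y ^ 2)) y := by
    intro y
    have hs := regDist_pos x hr y
    have hlow := hVlow y
    have hθ0 : 0 ≤ θ y := cutoff_nonneg b x R y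
    have hθ1 : θ y ≤ 1 := cutoff_le_one b x R y
    have hW : 0 ≤ 3 * r ^ 3 / (regDist x r y ^ 4 * (regDist x r y + r)) := by positivity
    by_cases hyB : y ∈ Metric.ball x R
    · rw [Set.indicator_of_mem hyB]
      have h1 : ‖∇ φ y‖ ^ 2 + D / lam ^ 2 * (r / R ^ 3) * φ y ^ 2 ≤
          max 1 (D / lam ^ 2) * (‖∇ φ y‖ ^ 2 + r / R ^ 3 * φ y ^ 2) := by
        have m1 := mul_le_mul_of_nonneg_right (le_max_left 1 (D / lam ^ 2)) (sq_nonneg ‖∇ φ y‖)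
        have m2 := mul_le_mul_of_nonneg_right (le_max_right 1 (D / lam ^ 2))
          (show 0 ≤ r / R ^ 3 * φ y ^ 2 by positivity)
        linarith
      have h2 := mul_le_mul_of_nonneg_right (hTF y) (sq_nonneg (φ y))
      have h3 := mul_le_mul_of_nonneg_right hθ1 (sq_nonneg ‖∇ φ y‖)
      by_cases hyA : y ∈ Metric.closedBall x (κ' * r)
      · rw [Set.indicator_of_mem hyA]
        have hyd : dist y x ≤ κ' * r := hyA
        have hθe : θ y = 1 := cutoff_eq_one b x hR0 (hyd.trans hA_R)
        have hsle : regDist x r y ≤ (1 + κ') * r := by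
          refine abs_le_of_sq_le_sq' ?_ (by positivity) |>.2
          rw [regDist_sq, ← dist_eq_norm]
          nlinarith [dist_nonneg (x := y) (y := x), mul_pos hκ'0 hr]
        have hWl : c * (r ^ 2)⁻¹ ≤ 3 * r ^ 3 / (regDist x r y ^ 4 * (regDist x r y + r)) := by
          have e : c * (r ^ 2)⁻¹
              = 3 * r ^ 3 / (((1 + κ') * r) ^ 4 * ((1 + κ') * r + r)) := by
            rw [hc]; field_simp; ring
          rw [e]
          gcongr
        have h4 := mul_le_mul_of_nonneg_right hWl (sq_nonneg (φ y))
        rw [hθe] at hlow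
        nlinarith
      · rw [Set.indicator_of_notMem hyA]
        have h4 : 0 ≤ θ y * φ y ^ 2 *
            (3 * r ^ 3 / (regDist x r y ^ 4 * (regDist x r y + r))) := by positivity
        nlinarith
    · have hyA : y ∉ Metric.closedBall x (κ' * r) := fun h => hyB <| by
        have : dist y x ≤ κ' * r := h
        rw [Metric.mem_ball]
        nlinarith
      rw [Set.indicator_of_notMem hyB, Set.indicator_of_notMem hyA]
      have hθz : θ y = 0 := cutoff_eq_zero b x hR0 (by
        rw [Metric.mem_ball, not_lt] at hyB
        change R * 1 ≤ dist y x
        rwa [mul_one])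
      have hgz : ∇ θ y = 0 := gradient_cutoff_of_eq_zero b x hθz
      rw [hθz, hgz] at hlow
      simpa using hlow
  have i1 : Integrable fun y => φ y ^ 2 := (memLp_test hφ hcs).integrable_sq
  have i2 : Integrable fun y => ‖∇ φ y‖ ^ 2 :=
    (memLp_two_iff_integrable_sq_norm (memLp_gradient hφ hcs).1).1 (memLp_gradient hφ hcs)
  have i3 : Integrable fun y => max 1 (D / lam ^ 2) * (‖∇ φ y‖ ^ 2 + r / R ^ 3 * φ y ^ 2) :=
    (i2.add (i1.const_mul _)).const_mul _
  have hI := integral_mono ((i1.const_mul (c * (r ^ 2)⁻¹)).indicator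
    Metric.isClosed_closedBall.measurableSet)
    (hint.add (i3.indicator Metric.isOpen_ball.measurableSet)) hpt
  rw [integral_indicator Metric.isClosed_closedBall.measurableSet] at hI
  simp only [Pi.add_apply] at hI
  rw [integral_add hint (i3.indicator Metric.isOpen_ball.measurableSet), hzero, zero_add,
    integral_indicator Metric.isOpen_ball.measurableSet, integral_const_mul, integral_const_mul]
    at hI
  rw [mul_assoc c⁻¹, le_inv_mul_iff₀ hc0, ← mul_assoc]
  exact hI

/-- A bump function equal to `1` on the unit ball and supported in a ball slightly smaller than
that of radius `κ`. -/
def innerBump (κ : ℝ) (hκ : 1 < κ) : ContDiffBump (0 : E3) :=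
  ⟨1, (1 + κ) / 2, one_pos, by linarith⟩

/-- Localisation of the energy near a separated ball. -/
theorem exists_local_energy {κ : ℝ} (hκ : 1 < κ) (m : ℝ) (hm : 0 ≤ m) : ∃ C : ℝ, 1 ≤ C ∧
    ∀ (x : E3) (r R ξ : ℝ) (hr : 0 < r), κ * r < R → r / R ^ 3 ≤ m * (ξ ^ 2)⁻¹ →
      ∀ u ∈ testFunctions ∅,
        screenedForm ξ (mulL (contDiff_cutoff (innerBump κ hκ) x r)
            (hasCompactSupport_cutoff (innerBump κ hκ) x hr) u)
          (mulL (contDiff_cutoff (innerBump κ hκ) x r)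
            (hasCompactSupport_cutoff (innerBump κ hκ) x hr) u)
          ≤ C * ∫ y in Metric.ball x R, (‖grad u y‖ ^ 2 + (ξ ^ 2)⁻¹ * toFun u y ^ 2) := by
  obtain ⟨A, hA, hardy⟩ := exists_local_hardy hκ
  obtain ⟨D, hD, hD'⟩ := exists_bumpConst (innerBump κ hκ)
  -- The 2 comes from |a + b|² ≤ 2|a|² + 2|b|². The rest bounds the term with the gradient of the
  -- cutoff, at most `D / r`, by Hardy's constant `A` and the factor `1 + m` that replaces `r / R³`
  -- by ξ⁻².
  refine ⟨2 + 2 * D ^ 2 * A * (1 + m), ?_, ?_⟩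
  · have : 0 ≤ 2 * D ^ 2 * A * (1 + m) := by positivity
    linarith
  rintro x r R ξ hr hR hmr u ⟨φ, hφ, hcs, -, hu⟩
  have hg := grad_ae_eq_gradient hφ hcs hu
  have hR0 : 0 < R := lt_trans (by nlinarith) hR
  set η := cutoff (innerBump κ hκ) x r with hη
  have hh := hardy x r R hr hR φ hφ hcs
  set A1 := Metric.closedBall x ((1 + κ) / 2 * r) with hA1
  set B1 := Metric.ball x R with hB1
  have hAB : A1 ⊆ B1 := Metric.closedBall_subset_ball (by nlinarith)
  have i1 : Integrable fun y => φ y ^ 2 := (memLp_test hφ hcs).integrable_sq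
  have i2 : Integrable fun y => ‖∇ φ y‖ ^ 2 :=
    (memLp_two_iff_integrable_sq_norm (memLp_gradient hφ hcs).1).1 (memLp_gradient hφ hcs)
  have mA : MeasurableSet A1 := Metric.isClosed_closedBall.measurableSet
  have mB : MeasurableSet B1 := Metric.isOpen_ball.measurableSet
  have hpt : ∀ y, ‖η y • ∇ φ y + φ y • ∇ η y‖ ^ 2 + (ξ ^ 2)⁻¹ * (η y * φ y) ^ 2
      ≤ B1.indicator (fun y => 2 * (‖∇ φ y‖ ^ 2 + (ξ ^ 2)⁻¹ * φ y ^ 2)) y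
        + A1.indicator (fun y => 2 * D ^ 2 * ((r ^ 2)⁻¹ * φ y ^ 2)) y := by
    intro y
    have h0 : 0 ≤ η y := cutoff_nonneg _ x r y
    have h1 : η y ≤ 1 := cutoff_le_one _ x r y
    by_cases hy : y ∈ A1
    · rw [Set.indicator_of_mem hy, Set.indicator_of_mem (hAB hy)]
      have h2 : ‖∇ η y‖ ^ 2 ≤ (D / r) ^ 2 :=
        pow_le_pow_left₀ (norm_nonneg _) (norm_gradient_cutoff_le _ x hD' hr y) 2
      have a3 : ‖η y • ∇ φ y + φ y • ∇ η y‖ ^ 2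
          ≤ 2 * (‖η y • ∇ φ y‖ ^ 2 + ‖φ y • ∇ η y‖ ^ 2) := by
        refine (pow_le_pow_left₀ (norm_nonneg _) (norm_add_le _ _) 2).trans ?_
        nlinarith [sq_nonneg (‖η y • ∇ φ y‖ - ‖φ y • ∇ η y‖)]
      rw [norm_smul, norm_smul, mul_pow, mul_pow, Real.norm_eq_abs, Real.norm_eq_abs, sq_abs,
        sq_abs] at a3
      have h3 : η y ^ 2 ≤ 1 := pow_le_one₀ h0 h1
      have h4 := mul_le_mul_of_nonneg_right h3 (sq_nonneg ‖∇ φ y‖)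
      have h5 := mul_le_mul_of_nonneg_left h2 (sq_nonneg (φ y))
      have h6 := mul_le_mul_of_nonneg_right h3
        (show 0 ≤ (ξ ^ 2)⁻¹ * φ y ^ 2 by positivity)
      have h7 : φ y ^ 2 * (D / r) ^ 2 = D ^ 2 * ((r ^ 2)⁻¹ * φ y ^ 2) := by
        rw [div_pow]; ring
      have h8 : 0 ≤ (ξ ^ 2)⁻¹ * φ y ^ 2 := by positivity
      have h9 : (ξ ^ 2)⁻¹ * (η y * φ y) ^ 2 = η y ^ 2 * ((ξ ^ 2)⁻¹ * φ y ^ 2) := by ring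
      rw [h9]
      linarith
    · have hz : η y = 0 := cutoff_eq_zero _ x hr (by
        rw [hA1, Metric.mem_closedBall, not_le] at hy
        change r * ((1 + κ) / 2) ≤ dist y x
        linarith)
      have hgz : ∇ η y = 0 := gradient_cutoff_of_eq_zero _ x hz
      rw [hz, hgz, Set.indicator_of_notMem hy]
      have : 0 ≤ B1.indicator (fun y => 2 * (‖∇ φ y‖ ^ 2 + (ξ ^ 2)⁻¹ * φ y ^ 2)) y :=
        Set.indicator_nonneg (fun y _ => by positivity) y
      simpa using this
  have iB : Integrable fun y => 2 * (‖∇ φ y‖ ^ 2 + (ξ ^ 2)⁻¹ * φ y ^ 2) :=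
    (i2.add (i1.const_mul _)).const_mul _
  have iA : Integrable fun y => 2 * D ^ 2 * ((r ^ 2)⁻¹ * φ y ^ 2) :=
    (i1.const_mul _).const_mul _
  have e1 : screenedForm ξ (mulL (contDiff_cutoff (innerBump κ hκ) x r)
            (hasCompactSupport_cutoff (innerBump κ hκ) x hr) u)
          (mulL (contDiff_cutoff (innerBump κ hκ) x r)
            (hasCompactSupport_cutoff (innerBump κ hκ) x hr) u)
      = ∫ y, (‖η y • ∇ φ y + φ y • ∇ η y‖ ^ 2 + (ξ ^ 2)⁻¹ * (η y * φ y) ^ 2) := by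
    rw [screenedForm_self]
    refine integral_congr_ae ?_
    filter_upwards [toFun_mulL (contDiff_cutoff (innerBump κ hκ) x r)
      (hasCompactSupport_cutoff (innerBump κ hκ) x hr) u,
      grad_mulL (contDiff_cutoff (innerBump κ hκ) x r)
      (hasCompactSupport_cutoff (innerBump κ hκ) x hr) u, hu, hg] with y k1 k2 k3 k4
    rw [k1, k2, k3, k4]
  have e2 : ∫ y in B1, (‖grad u y‖ ^ 2 + (ξ ^ 2)⁻¹ * toFun u y ^ 2)
      = ∫ y in B1, (‖∇ φ y‖ ^ 2 + (ξ ^ 2)⁻¹ * φ y ^ 2) := by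
    refine integral_congr_ae (ae_restrict_of_ae ?_)
    filter_upwards [hu, hg] with y k3 k4
    rw [k3, k4]
  rw [e1, e2]
  have hI := integral_mono_of_nonneg (Eventually.of_forall fun y => by positivity)
    ((iB.indicator mB).add (iA.indicator mA)) (Eventually.of_forall hpt)
  simp only [Pi.add_apply] at hI
  rw [integral_add (iB.indicator mB) (iA.indicator mA), integral_indicator mA,
    integral_indicator mB, integral_const_mul, integral_const_mul, integral_const_mul] at hI
  have hmono : ∫ y in B1, (‖∇ φ y‖ ^ 2 + r / R ^ 3 * φ y ^ 2)
      ≤ (1 + m) * ∫ y in B1, (‖∇ φ y‖ ^ 2 + (ξ ^ 2)⁻¹ * φ y ^ 2) := by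
    rw [← integral_const_mul]
    refine integral_mono (i2.add (i1.const_mul _)).integrableOn
      ((i2.add (i1.const_mul _)).const_mul _).integrableOn fun y => ?_
    have := mul_le_mul_of_nonneg_right hmr (sq_nonneg (φ y))
    have h8 : 0 ≤ (ξ ^ 2)⁻¹ * φ y ^ 2 := by positivity
    have h9 : 0 ≤ m * ‖∇ φ y‖ ^ 2 := by positivity
    simp only
    linarith
  set J := ∫ y in B1, (‖∇ φ y‖ ^ 2 + (ξ ^ 2)⁻¹ * φ y ^ 2)
  have h1 := hh.trans (mul_le_mul_of_nonneg_left hmono hA)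
  have h2 := mul_le_mul_of_nonneg_left h1 (show 0 ≤ 2 * D ^ 2 by positivity)
  linarith

/-! ### Reflections for a square summable family of projections -/

section AbstractReflections

variable {H I : Type*} [NormedAddCommGroup H] [NormedSpace ℝ H] {B : H →L[ℝ] H →L[ℝ] ℝ}

theorem form_add_self (hsymm : ∀ u v, B u v = B v u) (u v : H) :
    B (u + v) (u + v) = B u u + 2 * B u v + B v v := by
  rw [map_add, map_add, add_apply, add_apply, hsymm v u]
  ring

theorem form_sub_smul_self (hsymm : ∀ u v, B u v = B v u) (t : ℝ) (u v : H) :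
    B (u - t • v) (u - t • v) = B u u - 2 * t * B u v + t ^ 2 * B v v := by
  simp only [map_sub, map_smul, sub_apply, smul_apply, smul_eq_mul, hsymm v u]
  ring

/-- Young's inequality for a nonnegative symmetric form. -/
theorem two_mul_form_le (hsymm : ∀ u v, B u v = B v u) (hpos : ∀ u, 0 ≤ B u u) {t : ℝ} (ht : 0 < t)
    (u v : H) : 2 * B u v ≤ t * B u u + t⁻¹ * B v v := by
  have h := mul_nonneg (inv_nonneg.2 ht.le) (hpos (v - t • u))
  rw [form_sub_smul_self hsymm, hsymm v u] at h
  have e : t⁻¹ * (B v v - 2 * t * B u v + t ^ 2 * B u u)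
      = t⁻¹ * B v v - 2 * B u v + t * B u u := by
    field_simp
  linarith

theorem form_sum_left (S : Finset I) (w : I → H) (v : H) :
    B (∑ i ∈ S, w i) v = ∑ i ∈ S, B (w i) v := by
  rw [map_sum, sum_apply]

/-- Coercivity transfers the Cauchy criterion from the energies `a` to the vectors, which gives
unconditional convergence. -/
theorem summable_of_form_le [CompleteSpace H] {c M : ℝ} (hc : 0 < c)
    (hcoer : ∀ u, c * ‖u‖ ^ 2 ≤ B u u)
    {w : I → H} {a : I → ℝ} (ha : Summable a) (ha0 : ∀ i, 0 ≤ a i)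
    (h : ∀ S : Finset I, B (∑ i ∈ S, w i) (∑ i ∈ S, w i) ≤ M * ∑ i ∈ S, a i) : Summable w := by
  rw [summable_iff_vanishing_norm]
  intro ε hε
  obtain ⟨S, hS⟩ := summable_iff_vanishing_norm.1 ha (c * ε ^ 2 / (|M| + 1)) (by positivity)
  refine ⟨S, fun T hT => ?_⟩
  have h1 := hS T hT
  rw [Real.norm_of_nonneg (Finset.sum_nonneg fun i _ => ha0 i), lt_div_iff₀ (by positivity)] at h1
  have h2 := h T
  have h3 := hcoer (∑ i ∈ T, w i)
  have h4 : M * ∑ i ∈ T, a i ≤ (|M| + 1) * ∑ i ∈ T, a i :=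
    mul_le_mul_of_nonneg_right (by linarith [le_abs_self M]) (Finset.sum_nonneg fun i _ => ha0 i)
  have h5 : c * ‖∑ i ∈ T, w i‖ ^ 2 < c * ε ^ 2 := by linarith
  exact lt_of_pow_lt_pow_left₀ 2 hε.le (lt_of_mul_lt_mul_left h5 hc.le)

/-- A family of projections, orthogonal for a coercive form, that is square summable. -/
structure IsBesselFamily (B : H →L[ℝ] H →L[ℝ] ℝ) (Q : I → H →ₗ[ℝ] H) (c Λ : ℝ) : Prop where
  symm : ∀ u v, B u v = B v u
  c_pos : 0 < c
  coercive : ∀ u, c * ‖u‖ ^ 2 ≤ B u u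
  Λ_pos : 0 < Λ
  proj_symm : ∀ i u v, B (Q i u) v = B u (Q i v)
  proj_idem : ∀ i u, Q i (Q i u) = Q i u
  bessel : ∀ (S : Finset I) u, ∑ i ∈ S, B (Q i u) (Q i u) ≤ Λ * B u u

variable {Q : I → H →ₗ[ℝ] H} {c Λ : ℝ}

theorem IsBesselFamily.nonneg (h : IsBesselFamily B Q c Λ) (u : H) : 0 ≤ B u u :=
  (mul_nonneg h.c_pos.le (sq_nonneg _)).trans (h.coercive u)

theorem IsBesselFamily.form_proj_self (h : IsBesselFamily B Q c Λ) (i : I) (u : H) :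
    B (Q i u) (Q i u) = B (Q i u) u := by
  rw [h.proj_symm i u, h.proj_idem, ← h.proj_symm]

theorem IsBesselFamily.summable_form (h : IsBesselFamily B Q c Λ) (u : H) :
    Summable fun i => B (Q i u) (Q i u) :=
  summable_of_sum_le (fun _ => h.nonneg _) fun S => h.bessel S u

/-- A duality argument: with z = Σ Q_i u one has (z, z) = Σ (Q_i u, Q_i z). Young's inequality with
weight Λ and the Bessel bound applied to z itself allow one copy of (z, z) to be absorbed on the
left. -/
theorem IsBesselFamily.form_sum_le (h : IsBesselFamily B Q c Λ) (S : Finset I) (u : H) :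
    B (∑ i ∈ S, Q i u) (∑ i ∈ S, Q i u) ≤ Λ * ∑ i ∈ S, B (Q i u) (Q i u) := by
  set z := ∑ i ∈ S, Q i u with hz
  have h1 : 2 * B z z = ∑ i ∈ S, 2 * B (Q i u) (Q i z) := by
    conv_lhs => rw [hz]
    rw [form_sum_left, Finset.mul_sum]
    refine Finset.sum_congr rfl fun i _ => ?_
    rw [← h.proj_symm, h.proj_idem]
  have h2 : ∑ i ∈ S, 2 * B (Q i u) (Q i z)
      ≤ ∑ i ∈ S, (Λ * B (Q i u) (Q i u) + Λ⁻¹ * B (Q i z) (Q i z)) :=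
    Finset.sum_le_sum fun i _ => two_mul_form_le h.symm h.nonneg h.Λ_pos _ _
  replace h2 := h1.le.trans h2
  rw [Finset.sum_add_distrib, ← Finset.mul_sum, ← Finset.mul_sum] at h2
  have h3 := mul_le_mul_of_nonneg_left (h.bessel S z) (inv_nonneg.2 h.Λ_pos.le)
  rw [inv_mul_cancel_left₀ h.Λ_pos.ne'] at h3
  linarith

/-- Binomially weighted partial sums of the reflections perform a relaxed iteration. -/
theorem weighted_sum_succ {L : H →ₗ[ℝ] H} {Φ : ℕ → H} (h1 : Φ 1 = - L (Φ 0))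
    (h2 : ∀ k, Φ (k + 2) = Φ (k + 1) - L (Φ (k + 1))) {γ : ℝ} {q : ℕ → ℕ → ℝ}
    (q0 : ∀ N, q 0 N = 1) (qz : ∀ N, q (N + 1) N = 0)
    (qs : ∀ k N, q (k + 1) (N + 1) = (1 - γ) * q (k + 1) N + γ * q k N) (N : ℕ) :
    ∑ k ∈ Finset.range (N + 2), q k (N + 1) • Φ k =
      ∑ k ∈ Finset.range (N + 1), q k N • Φ k
        - γ • L (∑ k ∈ Finset.range (N + 1), q k N • Φ k) := by
  set Ψ := ∑ k ∈ Finset.range (N + 1), q k N • Φ k with hΨ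
  have a1 : ∑ k ∈ Finset.range (N + 1), q (k + 1) N • Φ (k + 1) = Ψ - Φ 0 := by
    have e := Finset.sum_range_succ' (fun k => q k N • Φ k) (N + 1)
    rw [Finset.sum_range_succ, qz, zero_smul, add_zero, q0, one_smul] at e
    rw [hΨ, e, add_sub_cancel_right]
  have a2 : ∑ k ∈ Finset.range (N + 1), q k N • Φ (k + 1) = Ψ - Φ 0 - L Ψ := by
    -- The first correction is -LΦ_0 rather than (1 - L)Φ_0; the conditional term accounts for this
    -- difference.
    have e : ∀ k, Φ (k + 1) = Φ k - L (Φ k) - if k = 0 then Φ 0 else 0 := by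
      rintro (_ | k)
      · rw [h1]; simp
      · rw [h2]; simp
    simp_rw [e, smul_sub, Finset.sum_sub_distrib, ← map_smul, ← map_sum]
    rw [← hΨ, Finset.sum_range_succ' _ N]
    simp only [Nat.add_eq_zero_iff, one_ne_zero, and_false, if_false, smul_zero,
      Finset.sum_const_zero, if_true, q0, one_smul, zero_add]
    abel
  rw [Finset.sum_range_succ']
  simp_rw [qs, q0, add_smul, mul_smul, Finset.sum_add_distrib, ← Finset.smul_sum]
  rw [a1, a2]
  module

variable [CompleteSpace H]

theorem IsBesselFamily.summable (h : IsBesselFamily B Q c Λ) (u : H) : Summable fun i => Q i u :=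
  summable_of_form_le h.c_pos h.coercive (h.summable_form u) (fun _ => h.nonneg _)
    fun S => h.form_sum_le S u

/-- The sum `L = ∑ i, Q i` of the projections. -/
def IsBesselFamily.sumProj (h : IsBesselFamily B Q c Λ) : H →ₗ[ℝ] H where
  toFun u := ∑' i, Q i u
  map_add' u v := by
    simp_rw [map_add]
    exact (h.summable u).tsum_add (h.summable v)
  map_smul' t u := by
    simp_rw [map_smul]
    exact (h.summable u).tsum_const_smul t

theorem IsBesselFamily.hasSum (h : IsBesselFamily B Q c Λ) (u : H) :
    HasSum (fun i => Q i u) (h.sumProj u) :=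
  (h.summable u).hasSum

theorem IsBesselFamily.hasSum_form (h : IsBesselFamily B Q c Λ) (u v : H) :
    HasSum (fun i => B (Q i u) v) (B (h.sumProj u) v) :=
  (h.hasSum u).mapL (B.flip v)

theorem IsBesselFamily.hasSum_form_self (h : IsBesselFamily B Q c Λ) (u : H) :
    HasSum (fun i => B (Q i u) (Q i u)) (B (h.sumProj u) u) := by
  simp_rw [h.form_proj_self]
  exact h.hasSum_form u u

theorem IsBesselFamily.sumProj_symm (h : IsBesselFamily B Q c Λ) (u v : H) :
    B (h.sumProj u) v = B u (h.sumProj v) := by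
  refine (h.hasSum_form u v).unique ?_
  rw [h.symm u]
  refine (h.hasSum_form v u).congr_fun fun i => ?_
  rw [h.proj_symm, h.symm]

/-- The limit of `form_sum_le` over finite sets. It expresses L² ≤ ΛL, the form of L ≤ Λ needed for
the contraction. -/
theorem IsBesselFamily.form_sumProj_le (h : IsBesselFamily B Q c Λ) (u : H) :
    B (h.sumProj u) (h.sumProj u) ≤ Λ * B (h.sumProj u) u := by
  have h1 : Tendsto (fun S : Finset I => B (∑ i ∈ S, Q i u) (∑ i ∈ S, Q i u)) atTop
      (𝓝 (B (h.sumProj u) (h.sumProj u))) := by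
    have hcont : Continuous fun z : H => B z z := B.continuous.clm_apply continuous_id
    exact (hcont.tendsto _).comp (h.hasSum u)
  exact le_of_tendsto_of_tendsto' h1 (Tendsto.const_mul Λ (h.hasSum_form_self u))
    fun S => h.form_sum_le S u

/-- Expanding the square, L² ≤ ΛL absorbs half of the cross term -2Λ⁻¹(Lv, v); the gap turns the
remaining -Λ⁻¹(Lv, v) into a definite decrease. -/
theorem IsBesselFamily.contraction (h : IsBesselFamily B Q c Λ) {δ : ℝ} {v : H}
    (hv : δ * B v v ≤ B (h.sumProj v) v) :
    B (v - Λ⁻¹ • h.sumProj v) (v - Λ⁻¹ • h.sumProj v) ≤ (1 - δ / Λ) * B v v := by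
  rw [form_sub_smul_self h.symm, h.symm v (h.sumProj v)]
  have h1 := mul_le_mul_of_nonneg_left (h.form_sumProj_le v)
    (show 0 ≤ Λ⁻¹ ^ 2 by positivity)
  have e : Λ⁻¹ ^ 2 * (Λ * B (h.sumProj v) v) = Λ⁻¹ * B (h.sumProj v) v := by
    have := h.Λ_pos.ne'
    field_simp
  have h2 := mul_le_mul_of_nonneg_left hv (inv_nonneg.2 h.Λ_pos.le)
  have e2 : (1 - δ / Λ) * B v v = B v v - Λ⁻¹ * (δ * B v v) := by ring
  rw [e] at h1
  rw [e2]
  linarith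

/-- The fixed point of the relaxed iteration is approached exponentially fast. -/
theorem IsBesselFamily.form_iterate_le (h : IsBesselFamily B Q c Λ) {δ : ℝ} (hδ : δ ≤ Λ)
    {V : Submodule ℝ H} (hV : ∀ z ∈ V, ∀ i, Q i z = 0)
    (hgap : ∀ v, (∀ z ∈ V, B v z = 0) → δ * B v v ≤ B (h.sumProj v) v)
    {Ψ : ℕ → H} (hΨ : ∀ N, Ψ (N + 1) = Ψ N - Λ⁻¹ • h.sumProj (Ψ N)) {u : H} (hu : u ∈ V)
    (hu0 : ∀ z ∈ V, B (Ψ 0 - u) z = 0) (N : ℕ) :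
    (∀ z ∈ V, B (Ψ N - u) z = 0) ∧
      B (Ψ N - u) (Ψ N - u) ≤ (1 - δ / Λ) ^ N * B (Ψ 0 - u) (Ψ 0 - u) := by
  have hL : ∀ z ∈ V, h.sumProj z = 0 := fun z hz => by
    refine (h.hasSum z).unique ?_
    simp_rw [hV z hz]
    exact hasSum_zero
  induction N with
  | zero => exact ⟨hu0, by simp⟩
  | succ N ih =>
    obtain ⟨h1, h2⟩ := ih
    have e : Ψ (N + 1) - u = (Ψ N - u) - Λ⁻¹ • h.sumProj (Ψ N - u) := by
      rw [hΨ, map_sub, hL u hu, sub_zero]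
      abel
    refine ⟨fun z hz => ?_, ?_⟩
    · rw [e, map_sub, map_smul, sub_apply, smul_apply, h.sumProj_symm, hL z hz, h1 z hz]
      simp
    · rw [e]
      refine (h.contraction (hgap _ h1)).trans ?_
      rw [pow_succ', mul_assoc]
      refine mul_le_mul_of_nonneg_left h2 ?_
      rw [sub_nonneg, div_le_one h.Λ_pos]
      exact hδ

/-- The corrections of the method of reflections are summable, and their sums follow a simple
recursion. -/
theorem IsBesselFamily.corrections (h : IsBesselFamily B Q c Λ) {Φ : H} {a : ℕ → I → H}
    (h0 : ∀ i, a 0 i = - Q i Φ)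
    (h1 : ∀ k i, a (k + 1) i = - Q i (∑' j : {j : I // j ≠ i}, a k j)) (k : ℕ) :
    Summable (a k) ∧ (∀ i, Q i (a k i) = a k i) := by
  classical
  induction k with
  | zero =>
    refine ⟨?_, fun i => ?_⟩
    · have : a 0 = fun i => - Q i Φ := funext h0
      rw [this]
      exact (h.summable Φ).neg
    · rw [h0, map_neg, h.proj_idem]
  | succ k ih =>
    refine ⟨?_, fun i => by rw [h1, map_neg, h.proj_idem]⟩
    -- The correction `a k i` lies in the range of `Q i`, so including the term `j = i` in the sum
    -- subtracts exactly `a k i`.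
    have e : a (k + 1) = fun i => - Q i (∑' j, a k j) + a k i := by
      funext i
      rw [h1]
      have := ih.1.sum_add_tsum_subtype_compl {i}
      rw [Finset.sum_singleton] at this
      have e2 : ∑' j : {j : I // j ≠ i}, a k j = ∑' j : {j : I // j ∉ ({i} : Finset I)}, a k j :=
        (Equiv.subtypeEquivRight (by simp)).tsum_eq
          fun j : {j : I // j ∉ ({i} : Finset I)} => a k j
      rw [e2, ← this, map_add, ih.2 i]
      abel
    rw [e]
    exact (h.summable _).neg.add ih.1

/-- Restoring the diagonal term makes every particle see the same total field; summation over the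
particles then gives 1 - L. -/
theorem IsBesselFamily.tsum_correction_succ (h : IsBesselFamily B Q c Λ) {Φ : H} {a : ℕ → I → H}
    (h0 : ∀ i, a 0 i = - Q i Φ)
    (h1 : ∀ k i, a (k + 1) i = - Q i (∑' j : {j : I // j ≠ i}, a k j)) (k : ℕ) :
    ∑' i, a (k + 1) i = ∑' i, a k i - h.sumProj (∑' i, a k i) := by
  classical
  have ih := h.corrections h0 h1 k
  have e : a (k + 1) = fun i => a k i - Q i (∑' j, a k j) := by
    funext i
    rw [h1]
    have := ih.1.sum_add_tsum_subtype_compl {i}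
    rw [Finset.sum_singleton] at this
    have e2 : ∑' j : {j : I // j ≠ i}, a k j = ∑' j : {j : I // j ∉ ({i} : Finset I)}, a k j :=
      (Equiv.subtypeEquivRight (by simp)).tsum_eq
        fun j : {j : I // j ∉ ({i} : Finset I)} => a k j
    rw [e2, ← this, map_add, ih.2 i]
    abel
  rw [e, ih.1.tsum_sub (h.summable _)]
  rfl

end AbstractReflections

/-! ### The weights as binomial tail probabilities -/

/-- The probability that a binomial variable is less than `k`. -/
def binomialCdf (γ : ℝ) (k N : ℕ) : ℝ :=
  ∑ m ∈ Finset.range k, (N.choose m : ℝ) * γ ^ m * (1 - γ) ^ (N - m)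

/-- The derivatives of consecutive binomial terms telescope: adding a term cancels the derivative
found so far and leaves that of the next order. -/
theorem hasDerivAt_binomialCdf (j l : ℕ) (t : ℝ) :
    HasDerivAt (fun t => binomialCdf t (j + 1) (j + 1 + l))
      (-(((j + 1 + l).factorial : ℝ) / (l.factorial * j.factorial) * (t ^ j * (1 - t) ^ l))) t := by
  have hsub : HasDerivAt (fun t : ℝ => 1 - t) (-1) t := by
    simpa using (hasDerivAt_id t).const_sub 1
  induction j generalizing l with
  | zero =>
    simp only [binomialCdf, zero_add, Finset.sum_range_one, Nat.choose_zero_right, Nat.cast_one,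
      pow_zero, one_mul, Nat.sub_zero]
    refine (hsub.pow (1 + l)).congr_deriv ?_
    rw [add_comm 1 l, Nat.factorial_succ]
    have : (l.factorial : ℝ) ≠ 0 := by positivity
    push_cast
    field_simp
    simp
  | succ j ih =>
    have h1 := ih (l + 1)
    rw [show j + 1 + (l + 1) = j + 1 + 1 + l by ring] at h1
    have h2 := (((hasDerivAt_id t).pow (j + 1)).const_mul
      ((j + 1 + 1 + l).choose (j + 1) : ℝ)).mul (hsub.pow (l + 1))
    have e : (fun t => binomialCdf t (j + 1 + 1) (j + 1 + 1 + l))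
        = fun t => binomialCdf t (j + 1) (j + 1 + 1 + l)
          + (j + 1 + 1 + l).choose (j + 1) * t ^ (j + 1) * (1 - t) ^ (l + 1) := by
      funext t
      rw [binomialCdf, Finset.sum_range_succ, show j + 1 + 1 + l - (j + 1) = l + 1 by omega]
      rfl
    rw [e]
    refine (h1.add h2).congr_deriv ?_
    have hch : ((j + 1 + 1 + l).choose (j + 1) : ℝ)
        = (j + 1 + 1 + l).factorial / ((j + 1).factorial * (l + 1).factorial) := by
      rw [show j + 1 + 1 + l = (j + 1) + (l + 1) by ring, Nat.cast_add_choose]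
    rw [hch, Nat.factorial_succ j, Nat.factorial_succ l]
    have f1 : (l.factorial : ℝ) ≠ 0 := by positivity
    have f2 : (j.factorial : ℝ) ≠ 0 := by positivity
    have f3 : (j + 1 : ℝ) ≠ 0 := by positivity
    have f4 : (l + 1 : ℝ) ≠ 0 := by positivity
    push_cast
    simp only [id]
    field_simp
    simp
    ring

/-- The incomplete Beta integral is the integrated derivative of the distribution function, which
equals 1 at `γ = 0`. For `k > N` the default weight 0 agrees, because the sum contains the whole
binomial expansion of 1. -/
theorem betaWeight_eq (γ : ℝ) (k N : ℕ) : betaWeight γ k N = 1 - binomialCdf γ k N := by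
  unfold betaWeight
  split_ifs with h0 hk
  · simp [binomialCdf, h0]
  · obtain ⟨j, rfl⟩ := Nat.exists_eq_succ_of_ne_zero h0
    obtain ⟨l, rfl⟩ := Nat.exists_eq_add_of_le hk
    have hint : IntervalIntegrable (fun t : ℝ =>
        -(((j + 1 + l).factorial : ℝ) / (l.factorial * j.factorial) * (t ^ j * (1 - t) ^ l)))
        volume 0 γ := by
      apply Continuous.intervalIntegrable
      fun_prop
    have h := intervalIntegral.integral_eq_sub_of_hasDerivAt
      (fun t _ => hasDerivAt_binomialCdf j l t) hint
    rw [intervalIntegral.integral_neg, intervalIntegral.integral_const_mul] at h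
    have hz : binomialCdf 0 (j + 1) (j + 1 + l) = 1 := by
      rw [binomialCdf, Finset.sum_range_succ']
      simp
    rw [hz] at h
    simp only [Nat.succ_eq_add_one, Nat.add_sub_cancel, Nat.add_sub_cancel_left]
    linarith
  · have hk' : N + 1 ≤ k := by omega
    have h1 : binomialCdf γ k N = binomialCdf γ (N + 1) N := by
      refine (Finset.sum_subset (Finset.range_mono hk') fun m _ hm => ?_).symm
      rw [Finset.mem_range, not_lt] at hm
      rw [Nat.choose_eq_zero_of_lt (by omega)]
      simp
    have h2 : binomialCdf γ (N + 1) N = 1 := by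
      have := add_pow γ (1 - γ) N
      rw [add_sub_cancel, one_pow] at this
      rw [this]
      exact Finset.sum_congr rfl fun m _ => by ring
    rw [h1, h2, sub_self]

theorem betaWeight_zero (γ : ℝ) (N : ℕ) : betaWeight γ 0 N = 1 := by simp [betaWeight]

theorem betaWeight_succ_self (γ : ℝ) (N : ℕ) : betaWeight γ (N + 1) N = 0 := by simp [betaWeight]

/-- Conditioning on one of the `N + 1` trials; algebraically this is Pascal's rule. -/
theorem betaWeight_succ_succ (γ : ℝ) (k N : ℕ) :
    betaWeight γ (k + 1) (N + 1)
      = (1 - γ) * betaWeight γ (k + 1) N + γ * betaWeight γ k N := by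
  have h : binomialCdf γ (k + 1) (N + 1)
      = (1 - γ) * binomialCdf γ (k + 1) N + γ * binomialCdf γ k N := by
    simp only [binomialCdf]
    rw [Finset.sum_range_succ', Finset.sum_range_succ' _ k, mul_add, Finset.mul_sum,
      Finset.mul_sum, add_right_comm, ← Finset.sum_add_distrib]
    congr 1
    · refine Finset.sum_congr rfl fun m _ => ?_
      rw [Nat.choose_succ_succ, Nat.add_sub_add_right]
      rcases lt_or_ge m N with hm | hm
      · rw [show N - m = N - (m + 1) + 1 by omega]
        push_cast
        ring
      · rw [Nat.choose_eq_zero_of_lt (show N < m + 1 by omega)]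
        push_cast
        ring
    · simp [pow_succ']
  rw [betaWeight_eq, betaWeight_eq, betaWeight_eq, h]
  ring

theorem tendsto_betaWeight {γ : ℝ} (h0 : 0 < γ) (h1 : γ < 1) (k : ℕ) :
    Tendsto (fun N => betaWeight γ k N) atTop (𝓝 1) := by
  simp_rw [betaWeight_eq]
  have hm : ∀ m : ℕ, Tendsto (fun N : ℕ => (N.choose m : ℝ) * γ ^ m * (1 - γ) ^ (N - m)) atTop
      (𝓝 0) := by
    intro m
    have hg : 0 < 1 - γ := by linarith
    -- Each binomial term is at most a constant times `N ^ m * (1 - γ) ^ N`, as the binomial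
    -- coefficient is at most `N ^ m`.
    have h2 := (tendsto_pow_const_mul_const_pow_of_abs_lt_one m
      (show |1 - γ| < 1 by rw [abs_of_pos hg]; linarith)).const_mul ((γ / (1 - γ)) ^ m)
    rw [mul_zero] at h2
    refine squeeze_zero' (Eventually.of_forall fun N => by positivity) ?_ h2
    filter_upwards [eventually_ge_atTop m] with N hN
    have h3 : ((N.choose m : ℕ) : ℝ) ≤ (N : ℝ) ^ m := by exact_mod_cast Nat.choose_le_pow N m
    have h4 : (1 - γ) ^ (N - m) = (1 - γ) ^ N / (1 - γ) ^ m := by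
      rw [eq_div_iff (by positivity), ← pow_add, Nat.sub_add_cancel hN]
    rw [h4]
    calc (N.choose m : ℝ) * γ ^ m * ((1 - γ) ^ N / (1 - γ) ^ m)
        ≤ (N : ℝ) ^ m * γ ^ m * ((1 - γ) ^ N / (1 - γ) ^ m) := by gcongr
      _ = _ := by rw [div_pow]; ring
  have := (tendsto_const_nhds (x := (1 : ℝ))).sub
    (tendsto_finsetSum (Finset.range k) fun m _ => hm m)
  simpa [binomialCdf] using this

/-! ### Orthogonal projections for the screened form -/

theorem weakSolution_eq {ξ : ℝ} (hξ : 0 < ξ) {V : Submodule ℝ H1} (hV : IsClosed (V : Set H1))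
    {f : Hneg1} {u : H1} (hu : IsWeakSolution ξ V f u) : weakSolution ξ V f = u :=
  (existsUnique_isWeakSolution hξ hV f).unique (weakSolution_spec hξ hV f) hu

theorem screenedProj_spec {ξ : ℝ} (hξ : 0 < ξ) {V : Submodule ℝ H1} (hV : IsClosed (V : Set H1))
    (u : H1) : IsWeakSolution ξ V (screenedForm ξ u) (screenedProj ξ V u) :=
  weakSolution_spec hξ hV _

/-- The projection onto the orthogonal complement of `V`, as a linear map. -/
def complProj {ξ : ℝ} (hξ : 0 < ξ) {V : Submodule ℝ H1} (hV : IsClosed (V : Set H1)) :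
    H1 →ₗ[ℝ] H1 where
  toFun u := u - screenedProj ξ V u
  map_add' u v := by
    have h : screenedProj ξ V (u + v) = screenedProj ξ V u + screenedProj ξ V v := by
      obtain ⟨h1, h2⟩ := screenedProj_spec hξ hV u
      obtain ⟨h3, h4⟩ := screenedProj_spec hξ hV v
      refine weakSolution_eq hξ hV ⟨V.add_mem h1 h3, fun z hz => ?_⟩
      rw [map_add, map_add, add_apply, add_apply, h2 z hz, h4 z hz]
    rw [h]
    abel
  map_smul' t u := by
    have h : screenedProj ξ V (t • u) = t • screenedProj ξ V u := by
      obtain ⟨h1, h2⟩ := screenedProj_spec hξ hV u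
      refine weakSolution_eq hξ hV ⟨V.smul_mem t h1, fun z hz => ?_⟩
      rw [map_smul, map_smul, smul_apply, smul_apply, h2 z hz]
    rw [h, smul_sub]
    rfl

section ComplProj

variable {ξ : ℝ} (hξ : 0 < ξ) {V : Submodule ℝ H1} (hV : IsClosed (V : Set H1))

theorem sub_complProj_mem (u : H1) : u - complProj hξ hV u ∈ V := by
  have : u - complProj hξ hV u = screenedProj ξ V u := sub_sub_cancel _ _
  rw [this]
  exact (screenedProj_spec hξ hV u).1

theorem form_complProj {z : H1} (hz : z ∈ V) (u : H1) :
    screenedForm ξ (complProj hξ hV u) z = 0 := by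
  change screenedForm ξ (u - screenedProj ξ V u) z = 0
  rw [map_sub, sub_apply, (screenedProj_spec hξ hV u).2 z hz, sub_self]

theorem complProj_eq_zero {u : H1} (hu : u ∈ V) : complProj hξ hV u = 0 :=
  sub_eq_zero.2 (weakSolution_eq hξ hV ⟨hu, fun _ _ => rfl⟩).symm

theorem mem_of_complProj_eq_zero {u : H1} (hu : complProj hξ hV u = 0) : u ∈ V := by
  have := sub_complProj_mem hξ hV u
  rwa [hu, sub_zero] at this

theorem complProj_eq_of_sub_mem {u w : H1} (h : u - w ∈ V) :
    complProj hξ hV u = complProj hξ hV w := by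
  rw [← sub_eq_zero, ← map_sub, complProj_eq_zero hξ hV h]

theorem complProj_idem (u : H1) : complProj hξ hV (complProj hξ hV u) = complProj hξ hV u :=
  (complProj_eq_of_sub_mem hξ hV (sub_complProj_mem hξ hV u)).symm

theorem form_complProj_complProj (u v : H1) :
    screenedForm ξ (complProj hξ hV u) (complProj hξ hV v)
      = screenedForm ξ (complProj hξ hV u) v := by
  have := form_complProj hξ hV (sub_complProj_mem hξ hV v) u
  rw [map_sub] at this
  linarith

theorem complProj_symm (u v : H1) :
    screenedForm ξ (complProj hξ hV u) v = screenedForm ξ u (complProj hξ hV v) := by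
  rw [← form_complProj_complProj hξ hV u v, screenedForm_symm ξ u,
    ← form_complProj_complProj hξ hV v u, screenedForm_symm]

/-- The projection onto the complement minimises the energy modulo `V`. -/
theorem form_complProj_le {u w : H1} (h : u - w ∈ V) :
    screenedForm ξ (complProj hξ hV u) (complProj hξ hV u) ≤ screenedForm ξ w w := by
  rw [complProj_eq_of_sub_mem hξ hV h]
  have e : w = complProj hξ hV w + (w - complProj hξ hV w) := by abel
  have h1 := form_add_self (screenedForm_symm ξ) (complProj hξ hV w) (w - complProj hξ hV w)
  rw [← e, form_complProj hξ hV (sub_complProj_mem hξ hV w)] at h1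
  have := screenedForm_nonneg ξ (w - complProj hξ hV w)
  linarith

end ComplProj

/-! ### Separated configurations and gluing of boundary conditions -/

theorem map_mem_H10 {T : H1 →L[ℝ] H1} {A K : Set E3}
    (h : ∀ u ∈ testFunctions A, T u ∈ H10 K) {u : H1} (hu : u ∈ H10 A) : T u ∈ H10 K :=
  closure_minimal (s := (testFunctions A : Set H1)) (t := T ⁻¹' (H10 K : Set H1)) h
    ((isClosed_H10 K).preimage T.continuous) hu

theorem testFunctions_le_H10 (K : Set E3) : testFunctions K ≤ H10 K :=
  (testFunctions K).le_topologicalClosure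

theorem H10_anti {A K : Set E3} (h : A ⊆ K) : H10 K ≤ H10 A :=
  Submodule.topologicalClosure_mono fun _ ⟨φ, h1, h2, h3, h4⟩ =>
    ⟨φ, h1, h2, fun y hy => h3 y (h hy), h4⟩

theorem mem_H10_empty (u : H1) : u ∈ H10 ∅ := by rw [H10_empty]; trivial

/-- The gradient of a product involves the gradient of the cutoff as well, so both are required to
vanish pointwise for one of the two factors. -/
theorem form_mulL_mulL_eq_zero (ξ : ℝ) {η η' : E3 → ℝ} (hη : ContDiff ℝ ∞ η)
    (hc : HasCompactSupport η) (hη' : ContDiff ℝ ∞ η') (hc' : HasCompactSupport η')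
    (h : ∀ y, (η y = 0 ∧ ∇ η y = 0) ∨ (η' y = 0 ∧ ∇ η' y = 0)) (u v : H1) :
    screenedForm ξ (mulL hη hc u) (mulL hη' hc' v) = 0 := by
  have h1 : inner ℝ (toFun (mulL hη hc u)) (toFun (mulL hη' hc' v)) = 0 := by
    rw [L2.inner_def]
    refine integral_eq_zero_of_ae ?_
    filter_upwards [toFun_mulL hη hc u, toFun_mulL hη' hc' v] with y k1 k2
    rw [k1, k2]
    rcases h y with ⟨a, -⟩ | ⟨a, -⟩ <;> simp [a]
  have h2 : inner ℝ (grad (mulL hη hc u)) (grad (mulL hη' hc' v)) = 0 := by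
    rw [L2.inner_def]
    refine integral_eq_zero_of_ae ?_
    filter_upwards [grad_mulL hη hc u, grad_mulL hη' hc' v] with y k1 k2
    rw [k1, k2]
    rcases h y with ⟨a, b⟩ | ⟨a, b⟩ <;> simp [a, b]
  rw [screenedForm_apply, h1, h2]
  simp

/-- A configuration of separated balls `B (x i) (r i)` inside disjoint balls `B (x i) (R i)`, with
capacity density controlled by the screening length `ξ`. -/
structure IsSeparated {I : Type*} (κ m ξ : ℝ) (x : I → E3) (r R : I → ℝ) : Prop where
  one_lt : 1 < κ
  ξ_pos : 0 < ξ
  r_pos : ∀ i, 0 < r i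
  lt_R : ∀ i, κ * r i < R i
  density : ∀ i, r i / R i ^ 3 ≤ m * (ξ ^ 2)⁻¹
  disj : ∀ i j, i ≠ j → R i + R j ≤ dist (x i) (x j)
  bounded : ∃ ρ, ∀ i, r i ≤ ρ
  closed : IsClosed (particles x r)

namespace IsSeparated

variable {I : Type*} {κ m ξ : ℝ} {x : I → E3} {r R : I → ℝ}

theorem R_pos (h : IsSeparated κ m ξ x r R) (i : I) : 0 < R i :=
  lt_trans (mul_pos (by linarith [h.one_lt]) (h.r_pos i)) (h.lt_R i)

/-- The cutoff function of the particle `i`. -/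
def bump (h : IsSeparated κ m ξ x r R) (i : I) : E3 → ℝ :=
  cutoff (innerBump κ h.one_lt) (x i) (r i)

theorem contDiff_bump (h : IsSeparated κ m ξ x r R) (i : I) : ContDiff ℝ ∞ (h.bump i) :=
  contDiff_cutoff _ _ _

theorem hasCompactSupport_bump (h : IsSeparated κ m ξ x r R) (i : I) :
    HasCompactSupport (h.bump i) :=
  hasCompactSupport_cutoff _ _ (h.r_pos i)

theorem bump_eq_one (h : IsSeparated κ m ξ x r R) {i : I} {y : E3}
    (hy : y ∈ Metric.closedBall (x i) (r i)) : h.bump i y = 1 :=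
  cutoff_eq_one _ _ (h.r_pos i) (by
    change dist y (x i) ≤ r i * 1
    rwa [mul_one])

theorem bump_eq_zero (h : IsSeparated κ m ξ x r R) {i : I} {y : E3}
    (hy : y ∉ Metric.ball (x i) (R i)) : h.bump i y = 0 :=
  cutoff_eq_zero _ _ (h.r_pos i) (by
    rw [Metric.mem_ball, not_lt] at hy
    change r i * ((1 + κ) / 2) ≤ dist y (x i)
    nlinarith [h.lt_R i, h.r_pos i, h.one_lt])

theorem disjoint_ball (h : IsSeparated κ m ξ x r R) {i j : I} (hij : i ≠ j) :
    Disjoint (Metric.ball (x i) (R i)) (Metric.ball (x j) (R j)) :=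
  Metric.ball_disjoint_ball (h.disj i j hij)

theorem closedBall_subset (h : IsSeparated κ m ξ x r R) (i : I) :
    Metric.closedBall (x i) (r i) ⊆ Metric.ball (x i) (R i) :=
  Metric.closedBall_subset_ball (by nlinarith [h.lt_R i, h.r_pos i, h.one_lt])

theorem bump_eq_zero_of_ne (h : IsSeparated κ m ξ x r R) {i j : I} (hij : i ≠ j) {y : E3}
    (hy : y ∈ Metric.closedBall (x j) (r j)) : h.bump i y = 0 :=
  h.bump_eq_zero fun hi => (h.disjoint_ball hij).le_bot ⟨hi, h.closedBall_subset j hy⟩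

/-- Multiplication by the cutoff function of the particle `i`. -/
def loc (h : IsSeparated κ m ξ x r R) (i : I) : H1 →L[ℝ] H1 :=
  mulL (h.contDiff_bump i) (h.hasCompactSupport_bump i)

theorem form_loc_eq_zero (h : IsSeparated κ m ξ x r R) {i j : I} (hij : i ≠ j) (u v : H1) :
    screenedForm ξ (h.loc i u) (h.loc j v) = 0 := by
  refine form_mulL_mulL_eq_zero ξ _ _ _ _ (fun y => ?_) u v
  by_cases hy : y ∈ Metric.ball (x i) (R i)
  · have h0 := h.bump_eq_zero (Set.disjoint_left.1 (h.disjoint_ball hij) hy)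
    exact Or.inr ⟨h0, gradient_cutoff_of_eq_zero _ _ h0⟩
  · have h0 := h.bump_eq_zero hy
    exact Or.inl ⟨h0, gradient_cutoff_of_eq_zero _ _ h0⟩

theorem loc_mem_of_ne (h : IsSeparated κ m ξ x r R) {i j : I} (hij : i ≠ j) (u : H1) :
    h.loc i u ∈ H10 (Metric.closedBall (x j) (r j)) := by
  refine map_mem_H10 (A := ∅) (fun v hv => testFunctions_le_H10 _ ?_) (mem_H10_empty u)
  obtain ⟨φ, hφ, -, -, hv⟩ := hv
  refine mulL_mem_testFunctions _ _ hφ hv fun y hy => ?_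
  rw [h.bump_eq_zero_of_ne hij hy, zero_mul]

theorem sub_loc_mem (h : IsSeparated κ m ξ x r R) (i : I) (u : H1) :
    u - h.loc i u ∈ H10 (Metric.closedBall (x i) (r i)) := by
  have := map_mem_H10 (T := ContinuousLinearMap.id ℝ H1 - h.loc i) (A := ∅)
    (K := Metric.closedBall (x i) (r i)) ?_ (mem_H10_empty u)
  · simpa using this
  rintro v ⟨φ, hφ, hc, -, hv⟩
  refine testFunctions_le_H10 _ ⟨fun y => φ y - h.bump i y * φ y,
    hφ.sub ((h.contDiff_bump i).mul hφ), hc.sub hc.mul_left, fun y hy => ?_, ?_⟩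
  · simp [h.bump_eq_one hy]
  · rw [sub_apply, map_sub]
    filter_upwards [Lp.coeFn_sub (toFun (ContinuousLinearMap.id ℝ H1 v)) (toFun (h.loc i v)), hv,
      toFun_mulL (h.contDiff_bump i) (h.hasCompactSupport_bump i) v] with y k1 k2 k3
    rw [k1, Pi.sub_apply, ContinuousLinearMap.id_apply, k2]
    refine congrArg (φ y - ·) ?_
    rw [← k2]
    exact k3

/-- Only finitely many particles meet a bounded set. -/
theorem finite_meet (h : IsSeparated κ m ξ x r R) (M : ℝ) :
    {i | (Metric.closedBall (x i) (r i) ∩ Metric.closedBall 0 M).Nonempty}.Finite := by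
  obtain ⟨ρ, hρ⟩ := h.bounded
  have hself : ∀ i, x i ∈ Metric.ball (x i) (R i) := fun i => Metric.mem_ball_self (h.R_pos i)
  -- The disjoint balls of radius `R` contain only their own centres.
  have huniq : ∀ i j, x i ∈ Metric.ball (x j) (R j) → i = j := fun i j hij => by
    by_contra hne
    exact (h.disjoint_ball hne).le_bot ⟨hself i, hij⟩
  have hinj : Function.Injective x := fun i j hij => huniq i j (by rw [hij]; exact hself j)
  by_contra hinf
  set S := {i | (Metric.closedBall (x i) (r i) ∩ Metric.closedBall 0 M).Nonempty} with hS
  have hinf' : (x '' S).Infinite := Set.Infinite.image hinj.injOn hinf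
  have hsub : x '' S ⊆ Metric.closedBall 0 (M + ρ) := by
    rintro _ ⟨i, ⟨y, hy1, hy2⟩, rfl⟩
    rw [Metric.mem_closedBall] at *
    have := dist_triangle (x i) y 0
    rw [dist_comm (x i) y] at this
    linarith [hρ i]
  obtain ⟨p, -, hp⟩ := hinf'.exists_accPt_of_subset_isCompact (isCompact_closedBall 0 (M + ρ)) hsub
  -- Infinitely many particles would make the centres accumulate at `p`. Closedness puts `p` into
  -- some particle `j`, and then a whole neighbourhood of `p` contains no centre except `x j`.
  have hpK : p ∈ particles x r := by
    refine h.closed.closure_subset_iff.2 ?_ (mem_closure_iff_clusterPt.2 hp.clusterPt)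
    rintro _ ⟨i, -, rfl⟩
    exact Set.mem_iUnion.2 ⟨i, Metric.mem_closedBall_self (h.r_pos i).le⟩
  obtain ⟨j, hj⟩ := Set.mem_iUnion.1 hpK
  have hfreq := accPt_iff_frequently.1 hp
  have hev : ∀ᶠ y in 𝓝 p, y ∈ Metric.ball (x j) (R j) :=
    Metric.isOpen_ball.mem_nhds (h.closedBall_subset j hj)
  by_cases hpj : p = x j
  · obtain ⟨y, ⟨hy1, i, -, rfl⟩, hy3⟩ := (hfreq.and_eventually hev).exists
    exact hy1 (by rw [hpj, huniq i j hy3])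
  · have hev2 : ∀ᶠ y in 𝓝 p, y ≠ x j := isOpen_ne.mem_nhds hpj
    obtain ⟨y, ⟨⟨hy1, i, -, rfl⟩, hy3⟩, hy4⟩ :=
      ((hfreq.and_eventually hev).and_eventually hev2).exists
    exact hy4 (by rw [huniq i j hy3])

/-- After truncation only finitely many particles matter. Their cutoffs η_i split the truncated
function into parts η_i χu, each needing only the condition on one ball, and the remainder (1 - Σ
η_i)χu, whose factor already vanishes on K. -/
theorem mem_H10_particles (h : IsSeparated κ m ξ x r R) {u : H1}
    (hu : ∀ i, u ∈ H10 (Metric.closedBall (x i) (r i))) : u ∈ H10 (particles x r) := by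
  classical
  refine (isClosed_H10 (particles x r)).mem_of_tendsto (tendsto_mulL_cutoff unitBump u)
    (Eventually.of_forall fun n => ?_)
  have hχ := contDiff_cutoff unitBump 0 (n + 1 : ℝ)
  have hχc := hasCompactSupport_cutoff unitBump 0 (r := (n + 1 : ℝ)) n.cast_add_one_pos
  set χ := cutoff unitBump 0 (n + 1 : ℝ) with hχd
  -- The factor 2 is the outer radius of `unitBump`: particles outside `S` lie where the truncation
  -- `χ` vanishes.
  set S := (h.finite_meet ((n + 1) * 2)).toFinset with hS
  have hχS : ∀ i ∉ S, ∀ y ∈ Metric.closedBall (x i) (r i), χ y = 0 := by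
    intro i hi y hy
    refine cutoff_eq_zero _ _ n.cast_add_one_pos ?_
    by_contra hlt
    refine hi ?_
    rw [hS, Set.Finite.mem_toFinset]
    exact ⟨y, hy, (not_le.1 hlt).le⟩
  set T : H1 →L[ℝ] H1 := mulL hχ hχc - ∑ i ∈ S, (h.loc i).comp (mulL hχ hχc) with hT
  have hTfun : ∀ v, toFun (T v) =ᵐ[volume]
      fun y => (1 - ∑ i ∈ S, h.bump i y) * χ y * toFun v y := by
    intro v
    have e : toFun (T v) = toFun (mulL hχ hχc v)
        - ∑ i ∈ S, toFun (h.loc i (mulL hχ hχc v)) := by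
      rw [hT, sub_apply, map_sub, sum_apply, map_sum]
      rfl
    rw [e]
    have k : ∀ i, ∀ᵐ y, toFun (h.loc i (mulL hχ hχc v)) y
        = h.bump i y * toFun (mulL hχ hχc v) y := fun i =>
      toFun_mulL (h.contDiff_bump i) (h.hasCompactSupport_bump i) _
    have k' : ∀ᵐ y, ∀ i ∈ S, toFun (h.loc i (mulL hχ hχc v)) y
        = h.bump i y * toFun (mulL hχ hχc v) y :=
      (S.eventually_all).2 fun i _ => k i
    filter_upwards [Lp.coeFn_sub (toFun (mulL hχ hχc v))
        (∑ i ∈ S, toFun (h.loc i (mulL hχ hχc v))),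
      Lp.coeFn_finsetSum S fun i => toFun (h.loc i (mulL hχ hχc v)),
      toFun_mulL hχ hχc v, k'] with y k1 k2 k3 k4
    rw [k1, Pi.sub_apply, k2, Finset.sum_apply, Finset.sum_congr rfl k4, ← Finset.sum_mul, k3]
    ring
  have hsmooth : ContDiff ℝ ∞ fun y => 1 - ∑ i ∈ S, h.bump i y :=
    contDiff_const.sub (ContDiff.sum fun i _ => h.contDiff_bump i)
  have hTu : T u ∈ H10 (particles x r) := by
    refine map_mem_H10 (A := ∅) (fun v hv => testFunctions_le_H10 _ ?_) (mem_H10_empty u)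
    obtain ⟨φ, hφ, hc, -, hv⟩ := hv
    refine ⟨fun y => (1 - ∑ i ∈ S, h.bump i y) * χ y * φ y, (hsmooth.mul hχ).mul hφ, hc.mul_left,
      fun y hy => ?_, ?_⟩
    · obtain ⟨j, hj⟩ := Set.mem_iUnion.1 hy
      beta_reduce
      by_cases hjS : j ∈ S
      · rw [Finset.sum_eq_single_of_mem j hjS fun i _ hij => h.bump_eq_zero_of_ne hij hj,
          h.bump_eq_one hj]
        ring
      · rw [hχS j hjS y hj]
        ring
    · filter_upwards [hTfun v, hv] with y k1 k2
      rw [k1, k2]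
  have hsum : ∑ i ∈ S, h.loc i (mulL hχ hχc u) ∈ H10 (particles x r) := by
    refine Submodule.sum_mem _ fun i _ => ?_
    refine map_mem_H10 (T := (h.loc i).comp (mulL hχ hχc)) (fun v hv => ?_) (hu i)
    obtain ⟨φ, hφ, hc, hφ0, hv⟩ := hv
    have hv' : toFun (mulL hχ hχc v) =ᵐ[volume] fun y => χ y * φ y := by
      filter_upwards [toFun_mulL hχ hχc v, hv] with y k1 k2
      rw [k1, k2]
    refine testFunctions_le_H10 _ (mulL_mem_testFunctions (h.contDiff_bump i)
      (h.hasCompactSupport_bump i) (hχ.mul hφ) hv' fun y hy => ?_)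
    obtain ⟨j, hj⟩ := Set.mem_iUnion.1 hy
    by_cases hij : i = j
    · subst hij
      rw [hφ0 y hj]
      ring
    · rw [h.bump_eq_zero_of_ne hij hj, zero_mul]
  have e : mulL hχ hχc u = T u + ∑ i ∈ S, h.loc i (mulL hχ hχc u) := by
    rw [hT, sub_apply, sum_apply]
    simp
  rw [e]
  exact Submodule.add_mem _ hTu hsum

end IsSeparated

/-! ### Bessel bound and spectral gap for the particles -/

/-- The projections `Q_i` as linear maps. -/
def particleProjL {I : Type*} {ξ : ℝ} (hξ : 0 < ξ) (x : I → E3) (r : I → ℝ) (i : I) :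
    H1 →ₗ[ℝ] H1 :=
  complProj hξ (isClosed_H10 (Metric.closedBall (x i) (r i)))

theorem correction_zero_eq {I : Type*} {ξ : ℝ} (hξ : 0 < ξ) (x : I → E3) (r : I → ℝ) (f : Hneg1)
    (i : I) : correction ξ x r f 0 i = - particleProjL hξ x r i (wholeSpaceSolution ξ f) := rfl

theorem correction_succ_eq {I : Type*} {ξ : ℝ} (hξ : 0 < ξ) (x : I → E3) (r : I → ℝ) (f : Hneg1)
    (k : ℕ) (i : I) : correction ξ x r f (k + 1) i
      = - particleProjL hξ x r i (∑' j : {j : I // j ≠ i}, correction ξ x r f k j) := rfl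

namespace IsSeparated

variable {I : Type*} {κ m ξ : ℝ} {x : I → E3} {r R : I → ℝ}

/-- The localised energies of separated configurations are bounded by the total energy, with a
constant that depends only on `κ` and `m`. -/
theorem exists_energy_bound (κ m : ℝ) (hm : 0 ≤ m) : ∃ C : ℝ, 1 ≤ C ∧
    ∀ {I : Type*} {ξ : ℝ} {x : I → E3} {r R : I → ℝ} (h : IsSeparated κ m ξ x r R) (S : Finset I)
      (u : H1), ∑ i ∈ S, screenedForm ξ (h.loc i u) (h.loc i u) ≤ C * screenedForm ξ u u := by
  by_cases hκ : 1 < κ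
  swap
  · exact ⟨1, le_rfl, fun h => absurd h.one_lt hκ⟩
  obtain ⟨C, hC, hloc⟩ := exists_local_energy hκ m hm
  refine ⟨C, hC, fun {I ξ x r R} h S u => ?_⟩
  have hcont : ∀ T : H1 →L[ℝ] H1, Continuous fun u => screenedForm ξ (T u) (T u) := fun T =>
    ((screenedForm ξ).continuous.comp T.continuous).clm_apply T.continuous
  have hcl : IsClosed {u : H1 | ∑ i ∈ S, screenedForm ξ (h.loc i u) (h.loc i u)
      ≤ C * screenedForm ξ u u} :=
    isClosed_le (continuous_finsetSum _ fun i _ => hcont (h.loc i))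
      (continuous_const.mul (hcont (ContinuousLinearMap.id ℝ H1)))
  -- Both sides are continuous in `u`, so density reduces the bound to test functions, for which the
  -- local estimates hold.
  refine hcl.closure_subset_iff.2 (fun v hv => ?_) (mem_H10_empty u)
  have h1 : ∑ i ∈ S, screenedForm ξ (h.loc i v) (h.loc i v) ≤
      ∑ i ∈ S, C * ∫ y in Metric.ball (x i) (R i), (‖grad v y‖ ^ 2 + (ξ ^ 2)⁻¹ * toFun v y ^ 2) :=
    Finset.sum_le_sum fun i _ =>
      hloc (x i) (r i) (R i) ξ (h.r_pos i) (h.lt_R i) (h.density i) v hv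
  have hint : Integrable fun y => ‖grad v y‖ ^ 2 + (ξ ^ 2)⁻¹ * toFun v y ^ 2 :=
    (integrable_sq_grad v).add ((integrable_sq_toFun v).const_mul _)
  refine h1.trans ?_
  rw [← Finset.mul_sum, ← integral_biUnion_finset S
    (fun i _ => Metric.isOpen_ball.measurableSet) (fun i _ j _ hij => h.disjoint_ball hij)
    (fun i _ => hint.integrableOn), screenedForm_self]
  exact mul_le_mul_of_nonneg_left
    (setIntegral_le_integral hint (Eventually.of_forall fun y => by positivity))
    (by linarith)

theorem sub_mem_iff (h : IsSeparated κ m ξ x r R) (i : I) (u : H1) :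
    particleProjL h.ξ_pos x r i u = 0 ↔ u ∈ H10 (Metric.closedBall (x i) (r i)) :=
  ⟨mem_of_complProj_eq_zero _ _, complProj_eq_zero _ _⟩

theorem isBesselFamily (h : IsSeparated κ m ξ x r R) {Λ : ℝ} (hΛ : 0 < Λ)
    (hE : ∀ (S : Finset I) (u : H1),
      ∑ i ∈ S, screenedForm ξ (h.loc i u) (h.loc i u) ≤ Λ * screenedForm ξ u u) :
    IsBesselFamily (screenedForm ξ) (particleProjL h.ξ_pos x r) (min 1 (ξ ^ 2)⁻¹) Λ where
  symm := screenedForm_symm ξ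
  c_pos := lt_min one_pos (by have := h.ξ_pos; positivity)
  coercive u := by
    rw [sq ‖u‖, ← mul_assoc]
    exact screenedForm_coercive ξ u
  Λ_pos := hΛ
  proj_symm i := complProj_symm _ _
  proj_idem i := complProj_idem _ _
  -- The localised function `h.loc i u` agrees with `u` on the ball, so it competes with `Q_i u` in
  -- the energy minimisation.
  bessel S u := (Finset.sum_le_sum fun i _ =>
    form_complProj_le h.ξ_pos (isClosed_H10 _) (h.sub_loc_mem i u)).trans (hE S u)

/-- The spectral gap of the sum of the projections. -/
theorem gap (h : IsSeparated κ m ξ x r R) {Λ : ℝ} (hΛ : 0 < Λ)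
    (hE : ∀ (S : Finset I) (u : H1),
      ∑ i ∈ S, screenedForm ξ (h.loc i u) (h.loc i u) ≤ Λ * screenedForm ξ u u)
    (v : H1) (hv : ∀ z ∈ H10 (particles x r), screenedForm ξ v z = 0) :
    Λ⁻¹ * screenedForm ξ v v ≤ screenedForm ξ ((h.isBesselFamily hΛ hE).sumProj v) v := by
  classical
  have hB := h.isBesselFamily hΛ hE
  set Q := particleProjL h.ξ_pos x r with hQ
  set w : I → H1 := fun i => h.loc i (Q i v) with hw
  have hws : ∀ S : Finset I, screenedForm ξ (∑ i ∈ S, w i) (∑ i ∈ S, w i)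
      ≤ Λ * ∑ i ∈ S, screenedForm ξ (Q i v) (Q i v) := by
    intro S
    rw [form_sum_left, Finset.mul_sum]
    refine Finset.sum_le_sum fun i hi => ?_
    -- The summands have disjoint supports, so only diagonal terms survive; each is bounded by the
    -- energy estimate for the single particle `i`.
    rw [map_sum, Finset.sum_eq_single_of_mem i hi fun j _ hj => h.form_loc_eq_zero hj.symm _ _]
    simpa using hE {i} (Q i v)
  have hwsum : Summable w := summable_of_form_le hB.c_pos hB.coercive (hB.summable_form v)
    (fun i => hB.nonneg _) hws
  set W := ∑' i, w i with hW
  have hWsum : HasSum w W := hwsum.hasSum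
  have hWle : screenedForm ξ W W ≤ Λ * screenedForm ξ (hB.sumProj v) v := by
    have hcont : Continuous fun z : H1 => screenedForm ξ z z :=
      (screenedForm ξ).continuous.clm_apply continuous_id
    exact le_of_tendsto_of_tendsto' ((hcont.tendsto _).comp hWsum)
      (Tendsto.const_mul Λ (hB.hasSum_form_self v)) hws
  have hmem : v - W ∈ H10 (particles x r) := by
    refine h.mem_H10_particles fun j => ?_
    have h1 : v - Q j v ∈ H10 (Metric.closedBall (x j) (r j)) := sub_complProj_mem _ _ v
    have h2 := h.sub_loc_mem j (Q j v)
    -- Removing the `j`-th term leaves a sum of functions that vanish on the ball `j`, and the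
    -- subspace is closed under limits.
    have h3 : W - w j ∈ H10 (Metric.closedBall (x j) (r j)) := by
      have hup := hWsum.update j 0
      rw [zero_sub, neg_add_eq_sub] at hup
      refine (isClosed_H10 _).mem_of_tendsto hup (Eventually.of_forall fun S => ?_)
      refine Submodule.sum_mem _ fun i _ => ?_
      by_cases hij : i = j
      · subst hij
        rw [Function.update_self]
        exact Submodule.zero_mem _
      · rw [Function.update_of_ne hij]
        exact h.loc_mem_of_ne hij _
    have e : v - W = (v - Q j v) + (Q j v - h.loc j (Q j v)) - (W - w j) := by
      simp only [hw]; abel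
    rw [e]
    exact Submodule.sub_mem _ (Submodule.add_mem _ h1 h2) h3
  have h0 := hv _ hmem
  rw [map_sub] at h0
  -- Orthogonality gives (v, v) = (v, W), so Young's inequality yields (v, v) ≤ (W, W).
  have h2 := two_mul_form_le (screenedForm_symm ξ) (screenedForm_nonneg ξ) one_pos v W
  rw [inv_mul_le_iff₀ hΛ]
  linarith

end IsSeparated

/-! ### Choice of radii and passage to the concrete iteration -/

/-- Existence of radii of disjoint balls that are large enough for the capacity density bound. -/
theorem exists_isSeparated {I : Type*} {α κ Cstar ξ μ₀ : ℝ} {x : I → E3} {r : I → ℝ} (hκ : 1 < κ)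
    (hξ : 0 < ξ) (hr : ∀ i, 0 < r i) (hcl : IsClosed (particles x r))
    (hdens : ∀ i, ENNReal.ofReal (r i) / nearestDist x i ^ 3 ≤ ENNReal.ofReal μ₀)
    (hsep : ∀ i, ENNReal.ofReal (κ * r i) < nearestDist x i / 2) (hα : ∀ i, r i ≤ α * ξ)
    (hμ : μ₀ ≤ Cstar * (ξ ^ 2)⁻¹) :
    ∃ R : I → ℝ, IsSeparated κ (8 * max Cstar 0 + 1) ξ x r R := by
  have hR : ∀ i, ∃ R : ℝ, κ * r i < R ∧ ENNReal.ofReal R ≤ nearestDist x i / 2 ∧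
      r i / R ^ 3 ≤ (8 * max Cstar 0 + 1) * (ξ ^ 2)⁻¹ := by
    intro i
    have hri := hr i
    by_cases htop : nearestDist x i = ⊤
    · refine ⟨κ * r i + 1 + r i * ξ ^ 2, ?_, ?_, ?_⟩
      · have : 0 < r i * ξ ^ 2 := by positivity
        linarith
      · rw [htop, ENNReal.top_div_of_ne_top (by simp)]
        exact le_top
      · set R := κ * r i + 1 + r i * ξ ^ 2 with hRd
        have h1 : 1 ≤ R := by
          have : 0 ≤ κ * r i + r i * ξ ^ 2 := by positivity
          linarith
        have h2 : r i * ξ ^ 2 ≤ R := by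
          have : 0 ≤ κ * r i + 1 := by positivity
          linarith
        have h3 : R ≤ R ^ 3 := le_self_pow₀ h1 (by norm_num)
        have h4 : r i / R ^ 3 ≤ (ξ ^ 2)⁻¹ := by
          rw [div_le_iff₀ (by positivity), ← div_eq_inv_mul, le_div_iff₀ (by positivity)]
          linarith
        have h5 : 0 ≤ 8 * max Cstar 0 * (ξ ^ 2)⁻¹ := by positivity
        linarith
    · set d := (nearestDist x i).toReal with hd
      have hde : nearestDist x i = ENNReal.ofReal d := (ENNReal.ofReal_toReal htop).symm
      have h2 : (2 : ℝ≥0∞) = ENNReal.ofReal 2 := by simp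
      have hs := hsep i
      rw [hde, h2, ← ENNReal.ofReal_div_of_pos two_pos] at hs
      have hd0 : κ * r i < d / 2 := (ENNReal.ofReal_lt_ofReal_iff_of_nonneg (by positivity)).1 hs
      have hdpos : 0 < d := by
        have : 0 < κ * r i := by positivity
        linarith
      -- Half the nearest distance keeps the balls disjoint; the cube of the 2 is the factor 8 in
      -- the density constant.
      refine ⟨d / 2, hd0, ?_, ?_⟩
      · rw [hde, h2, ← ENNReal.ofReal_div_of_pos two_pos]
      · have hdi := hdens i
        rw [hde, ← ENNReal.ofReal_pow hdpos.le, ← ENNReal.ofReal_div_of_pos (by positivity)] at hdi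
        have h3 : r i / d ^ 3 ≤ max μ₀ 0 := by
          rcases le_total μ₀ 0 with hμ0 | hμ0
          · rw [ENNReal.ofReal_of_nonpos hμ0, nonpos_iff_eq_zero, ENNReal.ofReal_eq_zero] at hdi
            exact hdi.trans (le_max_right _ _)
          · exact ((ENNReal.ofReal_le_ofReal_iff hμ0).1 hdi).trans (le_max_left _ _)
        have h4 : max μ₀ 0 ≤ max Cstar 0 * (ξ ^ 2)⁻¹ := by
          refine max_le (hμ.trans ?_) (by positivity)
          exact mul_le_mul_of_nonneg_right (le_max_left _ _) (by positivity)
        have h5 : r i / (d / 2) ^ 3 = 8 * (r i / d ^ 3) := by field_simp; norm_num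
        have h6 : 0 < (ξ ^ 2)⁻¹ := by positivity
        rw [h5]
        linarith
  choose R hR1 hR2 hR3 using hR
  refine ⟨R, hκ, hξ, hr, hR1, hR3, fun i j hij => ?_, ⟨α * ξ, hα⟩, hcl⟩
  have hRpos : ∀ i, 0 < R i := fun i =>
    lt_trans (mul_pos (by linarith) (hr i)) (hR1 i)
  have h1 : nearestDist x i ≤ edist (x i) (x j) := iInf₂_le j hij.symm
  have h2 : nearestDist x j ≤ edist (x i) (x j) := by
    rw [edist_comm]
    exact iInf₂_le i hij
  have h3 : ENNReal.ofReal (R i + R j) ≤ edist (x i) (x j) := by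
    rw [ENNReal.ofReal_add (hRpos i).le (hRpos j).le]
    calc ENNReal.ofReal (R i) + ENNReal.ofReal (R j)
        ≤ edist (x i) (x j) / 2 + edist (x i) (x j) / 2 :=
          add_le_add ((hR2 i).trans (ENNReal.div_le_div_right h1 2))
            ((hR2 j).trans (ENNReal.div_le_div_right h2 2))
      _ = edist (x i) (x j) := ENNReal.add_halves _
  rw [edist_dist] at h3
  exact (ENNReal.ofReal_le_ofReal_iff dist_nonneg).1 h3

theorem modifiedSum_succ {I : Type*} {Λ γ ξ c : ℝ} (hξ : 0 < ξ) {x : I → E3} {r : I → ℝ}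
    (hB : IsBesselFamily (screenedForm ξ) (particleProjL hξ x r) c Λ) (f : Hneg1) (N : ℕ) :
    modifiedSum γ ξ x r f (N + 1)
      = modifiedSum γ ξ x r f N - γ • hB.sumProj (modifiedSum γ ξ x r f N) := by
  refine weighted_sum_succ (Φ := reflection ξ x r f) ?_ (fun k => ?_) (betaWeight_zero γ)
    (betaWeight_succ_self γ) (betaWeight_succ_succ γ) N
  · have : (fun i => correction ξ x r f 0 i)
        = fun i => - particleProjL hξ x r i (wholeSpaceSolution ξ f) :=
      funext (correction_zero_eq hξ x r f)
    change ∑' i, correction ξ x r f 0 i = - ∑' i, particleProjL hξ x r i (wholeSpaceSolution ξ f)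
    rw [this, tsum_neg]
  · exact hB.tsum_correction_succ (correction_zero_eq hξ x r f) (correction_succ_eq hξ x r f) k

theorem wholeSpaceSolution_spec {ξ : ℝ} (hξ : 0 < ξ) (f : Hneg1) (v : H1) :
    screenedForm ξ (wholeSpaceSolution ξ f) v = f v :=
  (weakSolution_spec hξ (V := ⊤) isClosed_univ f).2 v trivial

theorem norm_wholeSpaceSolution_le {ξ : ℝ} (hξ : 0 < ξ) (f : Hneg1) :
    ‖wholeSpaceSolution ξ f‖ ≤ ‖f‖ / min 1 (ξ ^ 2)⁻¹ := by
  have hc : 0 < min 1 (ξ ^ 2)⁻¹ := lt_min one_pos (by positivity)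
  have h1 := screenedForm_coercive ξ (wholeSpaceSolution ξ f)
  rw [wholeSpaceSolution_spec hξ] at h1
  have h2 := (le_abs_self _).trans (f.le_opNorm (wholeSpaceSolution ξ f))
  rw [le_div_iff₀ hc]
  rcases (norm_nonneg (wholeSpaceSolution ξ f)).eq_or_lt with h0 | h0
  · rw [← h0, zero_mul]
    exact norm_nonneg f
  · have := le_of_mul_le_mul_right (h1.trans h2) h0
    linarith

end

end ScreenedReflections


/-! ### Proof of the theorem -/

open ScreenedReflections in
theorem theorem2 :
    -- the prefactor depends only on `ξ`
    ∃ C : ℝ → ℝ, ∀ α κ Cstar : ℝ, 1 < κ →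
      -- the weights and the rate depend only on `α`, `κ`, `Cstar`
      ∃ γ ε : ℝ, 0 < γ ∧ γ ≤ 1 ∧ 0 < ε ∧ ε < 1 ∧
        (∀ k : ℕ, Tendsto (fun N => betaWeight γ k N) atTop (𝓝 1)) ∧
        ∀ (I : Type*) [Countable I] (x : I → E3) (r : I → ℝ) (ξ μ₀ : ℝ),
          0 < ξ → (∀ i, 0 < r i) → IsClosed (particles x r) →
          -- capacity density, separation, and size of the particles
          (∀ i, ENNReal.ofReal (r i) / nearestDist x i ^ 3 ≤ ENNReal.ofReal μ₀) →
          (∀ i, ENNReal.ofReal (κ * r i) < nearestDist x i / 2) →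
          (∀ i, r i ≤ α * ξ) →
          μ₀ ≤ Cstar * (ξ ^ 2)⁻¹ →
          ∀ f : Hneg1,
            -- all the series that define the corrections converge in `H¹(ℝ³)`
            (∀ k, Summable (correction ξ x r f k)) ∧
            ∃ u : H1, IsWeakSolution ξ (H10 (particles x r)) f u ∧
              (∀ w : H1, IsWeakSolution ξ (H10 (particles x r)) f w → w = u) ∧
              Tendsto (fun N => normOn (particles x r)ᶜ (modifiedSum γ ξ x r f N - u))
                atTop (𝓝 0) ∧
              ∀ N : ℕ, normOn (particles x r)ᶜ (modifiedSum γ ξ x r f N - u)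
                ≤ C ξ * ε ^ N * ‖f‖ := by
  -- The coercivity constant enters the squared estimate twice, in the initial energy and in the
  -- passage from energy to norm; the square root leaves its inverse.
  refine ⟨fun ξ => (min 1 (ξ ^ 2)⁻¹)⁻¹, fun α κ Cstar hκ => ?_⟩
  obtain ⟨C, hC, hE⟩ := IsSeparated.exists_energy_bound κ (8 * max Cstar 0 + 1) (by positivity)
  -- Adding 1 makes Λ > 1 strictly, so that γ = Λ⁻¹ < 1, as the limit of the weights requires, and
  -- the rate 1 - Λ⁻² is positive.
  set Λ := C + 1 with hΛd
  have hΛ1 : 1 < Λ := by linarith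
  have hΛ0 : 0 < Λ := by linarith
  have hinv1 : Λ⁻¹ < 1 := inv_lt_one_of_one_lt₀ hΛ1
  have hinv0 : 0 < Λ⁻¹ := inv_pos.2 hΛ0
  have hq0 : 0 < 1 - Λ⁻¹ / Λ := by
    rw [sub_pos, div_lt_one hΛ0]
    linarith
  have hq1 : 1 - Λ⁻¹ / Λ < 1 := by
    have : 0 < Λ⁻¹ / Λ := by positivity
    linarith
  -- The square root appears because the contraction is stated for the squared energy norm.
  set ε := √(1 - Λ⁻¹ / Λ) with hεd
  have hε0 : 0 < ε := Real.sqrt_pos.2 hq0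
  have hε1 : ε < 1 := by
    rw [hεd, Real.sqrt_lt' one_pos]
    linarith
  have hεsq : ε ^ 2 = 1 - Λ⁻¹ / Λ := Real.sq_sqrt hq0.le
  refine ⟨Λ⁻¹, ε, hinv0, hinv1.le, hε0, hε1, tendsto_betaWeight hinv0 hinv1, ?_⟩
  intro I _ x r ξ μ₀ hξ hr hcl hdens hsep hα hμ f
  obtain ⟨R, h⟩ := exists_isSeparated hκ hξ hr hcl hdens hsep hα hμ
  have hE' : ∀ (S : Finset I) (u : H1),
      ∑ i ∈ S, screenedForm ξ (h.loc i u) (h.loc i u) ≤ Λ * screenedForm ξ u u := fun S u =>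
    (hE h S u).trans (mul_le_mul_of_nonneg_right (by linarith) (screenedForm_nonneg ξ u))
  have hB := h.isBesselFamily hΛ0 hE'
  have hc := hB.c_pos
  refine ⟨fun k =>
    (hB.corrections (correction_zero_eq hξ x r f) (correction_succ_eq hξ x r f) k).1, ?_⟩
  obtain ⟨u, hu, huniq⟩ := existsUnique_isWeakSolution hξ (isClosed_H10 (particles x r)) f
  have hzero : modifiedSum Λ⁻¹ ξ x r f 0 = wholeSpaceSolution ξ f := by
    simp [modifiedSum, betaWeight_zero, reflection]
  have horth : ∀ z ∈ H10 (particles x r),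
      screenedForm ξ (modifiedSum Λ⁻¹ ξ x r f 0 - u) z = 0 := fun z hz => by
    rw [hzero, map_sub, sub_apply, wholeSpaceSolution_spec hξ, hu.2 z hz, sub_self]
  have hδ : Λ⁻¹ ≤ Λ := by linarith
  have hiter := fun N => (hB.form_iterate_le hδ (V := H10 (particles x r))
    (fun z hz i => (h.sub_mem_iff i z).2
      (H10_anti (Set.subset_iUnion (fun i => Metric.closedBall (x i) (r i)) i) hz))
    (h.gap hΛ0 hE') (modifiedSum_succ hξ hB f) hu.1 horth N).2
  have hstart : screenedForm ξ (modifiedSum Λ⁻¹ ξ x r f 0 - u) (modifiedSum Λ⁻¹ ξ x r f 0 - u)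
      ≤ ‖f‖ ^ 2 / min 1 (ξ ^ 2)⁻¹ := by
    -- Pythagoras: u is the projection of Φ_0, so the energy of Φ_0 - u is at most that of Φ_0,
    -- which is ⟨f, Φ_0⟩.
    have h1 := form_add_self (screenedForm_symm ξ) (modifiedSum Λ⁻¹ ξ x r f 0 - u) u
    rw [sub_add_cancel, horth u hu.1, hzero, wholeSpaceSolution_spec hξ] at h1
    have h2 := (le_abs_self _).trans (f.le_opNorm (wholeSpaceSolution ξ f))
    have h3 := mul_le_mul_of_nonneg_left (norm_wholeSpaceSolution_le hξ f) (norm_nonneg f)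
    have h4 := screenedForm_nonneg ξ u
    rw [hzero, sq, mul_div_assoc]
    linarith
  have hbound : ∀ N : ℕ, normOn (particles x r)ᶜ (modifiedSum Λ⁻¹ ξ x r f N - u)
      ≤ (min 1 (ξ ^ 2)⁻¹)⁻¹ * ε ^ N * ‖f‖ := by
    intro N
    refine (normOn_le_norm _ _).trans (abs_le_of_sq_le_sq' ?_ (by positivity)).2
    have h1 := (hB.coercive (modifiedSum Λ⁻¹ ξ x r f N - u)).trans ((hiter N).trans
      (mul_le_mul_of_nonneg_left hstart (pow_nonneg hq0.le N)))
    rw [← hεsq, ← le_div_iff₀' hc] at h1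
    refine h1.trans (le_of_eq ?_)
    rw [← pow_mul, mul_comm 2 N, pow_mul]
    field_simp
  refine ⟨u, hu, huniq, ?_, hbound⟩
  have hlim := ((tendsto_pow_atTop_nhds_zero_of_lt_one hε0.le hε1).const_mul
    (min 1 (ξ ^ 2)⁻¹)⁻¹).mul_const ‖f‖
  rw [mul_zero, zero_mul] at hlim
  exact squeeze_zero (fun N => Real.sqrt_nonneg _) hbound hlim
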